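/- For $N\ge 1$ consider the toy model system $$\partial_t b_j=-i|b_j|^2b_j+2i\,\overline{b_j}\,\bigl(b_{j-1}^2+b_{j+1}^2\bigr),\qquad 1\le j\le N,\qquad b_0=b_{N+1}=0,$$ for $b=(b_1,\dots,b_N)\in\mathbb C^N$. Let $\Sigma=\{x\in\mathbb C^N:\ |x_1|^2+\dots+|x_N|^2=1\}$ be the unit-mass sphere, with the metric inherited from $\mathbb C^N$, and for $1\le j\le N$ let $\mathbb T_j=\{x\in\Sigma:\ |x_j|=1,\ x_k=0 \text{ for all } k\ne j\}$. There are absolute constants $0<c\le C$ such that for every integer $N\ge 6$ and every $\varepsilon>0$ there exist a global solution $b:\mathbb R\to\mathbb C^N$ of the system and a time $T\ge 0$ for which $b(0)\in\Sigma$ lies within distance $\varepsilon$ of $\mathbb T_3$ and $b(T)\in\Sigma$ lies within distance $\varepsilon$ of $\mathbb T_{N-2}$. Moreover, this solution satisfies $$|b_3(0)|\ge 1-\varepsilon,\quad |b_j(0)|\le\varepsilon\ (j\ne 3),\qquad |b_{N-2}(T)|\ge 1-\varepsilon,\quad |b_j(T)|\le\varepsilon\ (j\ne N-2),$$ and $c\le\max_{1\le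 j\le N}|b_j(t)|\le C$ for all $0\le t\le T$. -/

import Mathlib

namespace ToyModel

/-- The phase space `ℂ^N` with its Euclidean (Hermitian) norm. -/
abbrev Phase (N : ℕ) : Type := EuclideanSpace ℂ (Fin N)

/-- The mode `b_j` of `b = (b_1, …, b_N)`, extended by zero: `b_j = 0` unless `1 ≤ j ≤ N`. -/
noncomputable def mode {N : ℕ} (b : Phase N) (j : ℕ) : ℂ :=
  if h : 1 ≤ j ∧ j ≤ N then b ⟨j - 1, by omega⟩ else 0

/-- The right-hand side of the equation for the mode `b_j` (used for `j ≥ 1` only):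
`-i |b_j|² b_j + 2 i conj(b_j) (b_{j-1}² + b_{j+1}²)`. -/
noncomputable def modeVelocity {N : ℕ} (b : Phase N) (j : ℕ) : ℂ :=
  -Complex.I * ((‖mode b j‖ ^ 2 : ℝ) : ℂ) * mode b j
    + 2 * Complex.I * (starRingEnd ℂ) (mode b j) * (mode b (j - 1) ^ 2 + mode b (j + 1) ^ 2)

/-- The toy model vector field on `ℂ^N`; the entry with index `i : Fin N` belongs to the
mode `j = i + 1`. -/
noncomputable def vectorField {N : ℕ} (b : Phase N) : Phase N :=
  WithLp.toLp 2 fun i : Fin N => modeVelocity b ((i : ℕ) + 1)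

/-- `b` is a global solution of the toy model system. -/
def IsSolution {N : ℕ} (b : ℝ → Phase N) : Prop :=
  ∀ t : ℝ, HasDerivAt b (vectorField (b t)) t

/-- The unit-mass sphere `Σ ⊂ ℂ^N`, with the metric inherited from `ℂ^N`. -/
abbrev massSphere (N : ℕ) : Set (Phase N) := Metric.sphere (0 : Phase N) 1

/-- The circle `𝕋_j ⊂ Σ`. -/
def circle (N j : ℕ) : Set (massSphere N) :=
  {x | ‖mode (x : Phase N) j‖ = 1 ∧ ∀ k : ℕ, k ≠ j → mode (x : Phase N) k = 0}

/-- The `ℓ^∞` norm of a point of `ℂ^N` (the norm of the function space `Fin N → ℂ` is the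
maximum of the moduli of the entries). -/
noncomputable def supNorm {N : ℕ} (b : Phase N) : ℝ := ‖WithLp.ofLp b‖

end ToyModel

/-! When one mode carries nearly all the mass, the phase-invariant bonds `b_j conj(b_{j+1})` on
either side of it are perturbed hyperbolic pairs with rates close to `±√3` (`hasDerivAt_bondUV`). On
the incoming bond `U` expands and `V` contracts. On the outgoing bond the roles are exchanged, and
`U = 0`, `V > 0` is the heteroclinic connection to the next circle.

The proof is a topological shadowing argument: a whole path of initial data, rather than one orbit,
is carried from circle to circle. A `Crossing` is a path of reachable points near a circle whose
ends lie in the two opposite expanding cones of the incoming bond. For the induction step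
`Crossing.step`, a second parameter is added by putting a tiny mass into the next, still empty, mode
(`exists_family`). In the parameter plane, the orbits that leave the circle through one cone are
separated from those that leave through the other. By the planar lemma
`exists_joinedIn_of_separates`, a path of parameters joins the two extreme seedings and consists of
orbits that stay near the circle for a long time. Along that path the earlier modes decay, while the
outgoing `V` grows until the mass moves to the next mode (`Passage.departure`,
`Passage.exists_transit`).

The product `U V` of the outgoing bond is almost conserved, because the hyperbolic rates cancel in
its derivative. At the two ends of the path it starts with opposite signs and keeps them. At the
next circle `U` expands, so the two ends enter opposite cones there (`Passage.exists_exit`), which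
gives a crossing at the next circle. Induction from `crossing_third_circle` reaches the circle of
the mode `N - 2`. At all times some mode has action above `1/4`, which `Reach` records and which
gives the lower bound on the sup norm. -/

namespace ToyModel

open Set Filter Topology

section

/-! ### Planar topology -/

lemma abs_sub_lt_pi_of_antiperiodic {θ : ℝ × ℝ → ℝ} (hθ : Continuous θ) {s : ℝ → ℝ}
    (hs : ∀ x, s (x + Real.pi) = -s x) {A : Set (ℝ × ℝ)} (hA : Convex ℝ A)
    (hpos : ∀ x ∈ A, 0 < s (θ x)) {x y : ℝ × ℝ} (hx : x ∈ A) (hy : y ∈ A) :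
    |θ x - θ y| < Real.pi := by
  have key : ∀ x ∈ A, ∀ y ∈ A, θ y - θ x < Real.pi := by
    intro x hx y hy
    by_contra! h
    -- A variation of `π` or more would pass through `θ x + π`, where `s` has the opposite sign.
    obtain ⟨z, hz, hz'⟩ := hA.isPreconnected.intermediate_value hx hy hθ.continuousOn
      (show θ x + Real.pi ∈ Icc (θ x) (θ y) from ⟨by linarith [Real.pi_pos], by linarith⟩)
    have h1 := hpos z hz
    rw [hz', hs] at h1
    linarith [hpos x hx]
  rw [abs_lt]
  constructor
  · linarith [key x hx y hy]
  · linarith [key y hy x hx]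

/-- The two-dimensional Poincaré–Miranda theorem, for functions on the whole plane. -/
theorem exists_common_zero {f g : ℝ × ℝ → ℝ} (hf : Continuous f) (hg : Continuous g)
    (hl : ∀ z : ℝ × ℝ, z.1 ≤ 0 → f z < 0) (hr : ∀ z : ℝ × ℝ, 1 ≤ z.1 → 0 < f z)
    (hb : ∀ z : ℝ × ℝ, z.2 ≤ -1 → g z < 0) (ht : ∀ z : ℝ × ℝ, 1 ≤ z.2 → 0 < g z) :
    ∃ z, f z = 0 ∧ g z = 0 := by
  by_contra! hne
  let F : ℝ × ℝ → ℂ := fun z => (f z : ℂ) + (g z : ℂ) * Complex.I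
  have hF : Continuous F := by fun_prop
  have hF0 : ∀ z, F z ≠ 0 := by
    intro z hz
    have h1 := congrArg Complex.re hz
    have h2 := congrArg Complex.im hz
    simp [F] at h1 h2
    exact hne z h1 h2
  -- Without a common zero, `f + i g` maps the simply connected plane into `ℂ \ {0}`, so it has a
  -- continuous logarithm and hence a continuous angle `θ`.
  have hcov := Complex.isCoveringMapOn_exp.existsUnique_continuousMap_lifts
    (⟨F, hF⟩ : C(ℝ × ℝ, ℂ)) (a₀ := (0, 0)) (e₀ := Complex.log (F (0, 0)))
    (Complex.exp_log (hF0 _)) (fun a => hF0 a)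
  obtain ⟨G, ⟨-, hG⟩, -⟩ := hcov
  have hG' : ∀ z, Complex.exp (G z) = F z := fun z => congrFun hG z
  let θ : ℝ × ℝ → ℝ := fun z => (G z).im
  have hθ : Continuous θ := by fun_prop
  have hre : ∀ z, f z = Real.exp (G z).re * Real.cos (θ z) := by
    intro z
    have := congrArg Complex.re (hG' z)
    rw [Complex.exp_re] at this
    simpa [F] using this.symm
  have him : ∀ z, g z = Real.exp (G z).re * Real.sin (θ z) := by
    intro z
    have := congrArg Complex.im (hG' z)
    rw [Complex.exp_im] at this
    simpa [F] using this.symm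
  have cpos : ∀ z : ℝ × ℝ, 1 ≤ z.1 → 0 < Real.cos (θ z) := fun z hz =>
    (pos_iff_pos_of_mul_pos (hre z ▸ hr z hz)).1 (Real.exp_pos _)
  have cneg : ∀ z : ℝ × ℝ, z.1 ≤ 0 → Real.cos (θ z) < 0 := fun z hz => by
    have := hre z ▸ hl z hz
    exact neg_of_mul_neg_right this (Real.exp_pos _).le
  have spos : ∀ z : ℝ × ℝ, 1 ≤ z.2 → 0 < Real.sin (θ z) := fun z hz =>
    (pos_iff_pos_of_mul_pos (him z ▸ ht z hz)).1 (Real.exp_pos _)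
  have sneg : ∀ z : ℝ × ℝ, z.2 ≤ -1 → Real.sin (θ z) < 0 := fun z hz => by
    have := him z ▸ hb z hz
    exact neg_of_mul_neg_right this (Real.exp_pos _).le
  have d1 := abs_sub_lt_pi_of_antiperiodic hθ Real.sin_add_pi
    (A := {z : ℝ × ℝ | 1 ≤ z.2}) (convex_halfSpace_ge (IsLinearMap.mk (by simp) (by simp)) 1)
    (fun z hz => spos z hz) (x := (0, 1)) (y := (1, 1)) (by simp) (by simp)
  have d2 := abs_sub_lt_pi_of_antiperiodic hθ (s := fun x => -Real.cos x)
    (by simp) (A := {z : ℝ × ℝ | z.1 ≤ 0})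
    (convex_halfSpace_le (IsLinearMap.mk (by simp) (by simp)) 0)
    (fun z hz => neg_pos.2 (cneg z hz)) (x := (0, -1)) (y := (0, 1)) (by simp) (by simp)
  have d3 := abs_sub_lt_pi_of_antiperiodic hθ (s := fun x => -Real.sin x)
    (by simp) (A := {z : ℝ × ℝ | z.2 ≤ -1})
    (convex_halfSpace_le (IsLinearMap.mk (by simp) (by simp)) (-1))
    (fun z hz => neg_pos.2 (sneg z hz)) (x := (1, -1)) (y := (0, -1)) (by simp) (by simp)
  have d4 := abs_sub_lt_pi_of_antiperiodic hθ Real.cos_add_pi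
    (A := {z : ℝ × ℝ | 1 ≤ z.1}) (convex_halfSpace_ge (IsLinearMap.mk (by simp) (by simp)) 1)
    (fun z hz => cpos z hz) (x := (1, 1)) (y := (1, -1)) (by simp) (by simp)
  -- Counterclockwise along each side of the square the angle increases: the sine of the increment
  -- is positive and the increment is below `π` in modulus. The four increments sum to zero, a
  -- contradiction.
  have key : ∀ a b : ℝ, |a - b| < Real.pi →
      0 < Real.sin a * Real.cos b - Real.cos a * Real.sin b → 0 < a - b := by
    intro a b hab h
    rw [← Real.sin_sub] at h
    by_contra! h'
    have := Real.sin_nonpos_of_nonpos_of_neg_pi_le h' (by linarith [(abs_lt.1 hab).1])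
    linarith
  have c1 := cpos (1, 1) (by simp)
  have c2 := cneg (0, 1) (by simp)
  have c3 := cneg (0, -1) (by simp)
  have c4 := cpos (1, -1) (by simp)
  have s1 := spos (1, 1) (by simp)
  have s2 := spos (0, 1) (by simp)
  have s3 := sneg (0, -1) (by simp)
  have s4 := sneg (1, -1) (by simp)
  have e1 := key _ _ d1 (by nlinarith [mul_pos s2 c1, mul_pos (neg_pos.2 c2) s1])
  have e2 := key _ _ d2 (by nlinarith [mul_pos_of_neg_of_neg s3 c2, mul_neg_of_neg_of_pos c3 s2])
  have e3 := key _ _ d3 (by nlinarith [mul_pos_of_neg_of_neg s4 c3, mul_neg_of_pos_of_neg c4 s3])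
  have e4 := key _ _ d4 (by nlinarith [mul_pos s1 c4, mul_pos c1 (neg_pos.2 s4)])
  linarith

/-- An open neighbourhood of a closed set separating the left side of a strip from its right side
contains a path from the bottom to the top. -/
theorem exists_joinedIn_of_separates {Wm Wp O : Set (ℝ × ℝ)} (hWm : IsOpen Wm) (hWp : IsOpen Wp)
    (hO : IsOpen O) (hdisj : Disjoint Wm Wp) (hcov : ∀ z, z ∉ Wm → z ∉ Wp → z ∈ O)
    (hl : ∀ z : ℝ × ℝ, z.1 ≤ 0 → z ∈ Wm) (hr : ∀ z : ℝ × ℝ, 1 ≤ z.1 → z ∈ Wp) :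
    ∃ x y : ℝ × ℝ, x.2 ≤ -1 ∧ 1 ≤ y.2 ∧ JoinedIn O x y := by
  by_contra! hno
  -- `O₁` is the part of `O` connected to the bottom. It is open, and so is the rest of `O`. If no
  -- path reached the top, the separating set `Z` would split into two disjoint closed pieces, one
  -- attached to the bottom and the other to the top.
  let O₁ : Set (ℝ × ℝ) := {z | ∃ x : ℝ × ℝ, x.2 ≤ -1 ∧ JoinedIn O x z}
  have hball : ∀ z ∈ O, ∃ U ∈ 𝓝 z, ∀ w ∈ U, JoinedIn O z w := by
    intro z hz
    obtain ⟨r, hr, hrO⟩ := Metric.isOpen_iff.1 hO z hz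
    refine ⟨Metric.ball z r, Metric.ball_mem_nhds z hr, fun w hw => ?_⟩
    exact (((convex_ball z r).isPathConnected ⟨z, Metric.mem_ball_self hr⟩).joinedIn z
      (Metric.mem_ball_self hr) w hw).mono hrO
  have hO₁ : IsOpen O₁ := by
    rw [isOpen_iff_mem_nhds]
    rintro z ⟨x, hx, hxz⟩
    obtain ⟨U, hU, h⟩ := hball z hxz.target_mem
    exact mem_of_superset hU fun w hw => ⟨x, hx, hxz.trans (h w hw)⟩
  have hO₂ : IsOpen (O \ O₁) := by
    rw [isOpen_iff_mem_nhds]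
    rintro z ⟨hz, hz'⟩
    obtain ⟨U, hU, h⟩ := hball z hz
    refine mem_of_superset hU fun w hw => ⟨(h w hw).target_mem, ?_⟩
    rintro ⟨x, hx, hxw⟩
    exact hz' ⟨x, hx, hxw.trans (h w hw).symm⟩
  have hO₁O : O₁ ⊆ O := fun z ⟨x, _, h⟩ => h.target_mem
  let Z : Set (ℝ × ℝ) := (Wm ∪ Wp)ᶜ
  have hZ : IsClosed Z := (hWm.union hWp).isClosed_compl
  have hZO : Z ⊆ O := fun z hz => hcov z (fun h => hz (Or.inl h)) (fun h => hz (Or.inr h))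
  let C₁ : Set (ℝ × ℝ) := (Z ∩ (O \ O₁)ᶜ) ∪ {z | z.2 ≤ -1}
  let C₂ : Set (ℝ × ℝ) := (Z ∩ O₁ᶜ) ∪ {z | 1 ≤ z.2}
  have hC₁ : IsClosed C₁ :=
    (hZ.inter hO₂.isClosed_compl).union (isClosed_le continuous_snd continuous_const)
  have hC₂ : IsClosed C₂ :=
    (hZ.inter hO₁.isClosed_compl).union (isClosed_le continuous_const continuous_snd)
  have hCd : Disjoint C₁ C₂ := by
    rw [Set.disjoint_left]
    rintro z (⟨hz, hz'⟩ | hz) (⟨hw, hw'⟩ | hw)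
    · exact hz' ⟨hZO hz, hw'⟩
    · have hz1 : z ∈ O₁ := by
        by_contra h
        exact hz' ⟨hZO hz, h⟩
      obtain ⟨x, hx, hxz⟩ := hz1
      exact hno x z hx hw hxz
    · exact hw' ⟨z, hz, JoinedIn.refl (hZO hw)⟩
    · simp only [mem_ofPred_eq] at hz hw
      linarith
  obtain ⟨g, hg1, hg2, -⟩ := exists_continuous_zero_one_of_isClosed hC₁ hC₂ hCd
  have hne1 : (Wmᶜ : Set (ℝ × ℝ)).Nonempty :=
    ⟨(1, 0), fun h => Set.disjoint_left.1 hdisj h (hr _ (by simp))⟩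
  have hne2 : (Wpᶜ : Set (ℝ × ℝ)).Nonempty :=
    ⟨(0, 0), fun h => Set.disjoint_left.1 hdisj (hl _ (by simp)) h⟩
  have hpm : ∀ z ∈ Wm, 0 < Metric.infDist z Wmᶜ := fun z hz =>
    (hWm.isClosed_compl.notMem_iff_infDist_pos hne1).1 (by simpa using hz)
  have hpp : ∀ z ∈ Wp, 0 < Metric.infDist z Wpᶜ := fun z hz =>
    (hWp.isClosed_compl.notMem_iff_infDist_pos hne2).1 (by simpa using hz)
  have hzm : ∀ z, z ∉ Wm → Metric.infDist z Wmᶜ = 0 := fun z hz =>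
    Metric.infDist_zero_of_mem hz
  have hzp : ∀ z, z ∉ Wp → Metric.infDist z Wpᶜ = 0 := fun z hz =>
    Metric.infDist_zero_of_mem hz
  -- The first function vanishes exactly on `Z`; on `Z` the second one only takes the values `±1/2`.
  obtain ⟨z, hz1, hz2⟩ := exists_common_zero
    (f := fun z => Metric.infDist z Wpᶜ - Metric.infDist z Wmᶜ) (g := fun z => g z - 1 / 2)
    ((Metric.continuous_infDist_pt _).sub (Metric.continuous_infDist_pt _)) (by fun_prop)
    (fun z hz => by
      have h1 := hl z hz
      have h2 := hzp z (Set.disjoint_left.1 hdisj h1)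
      have h3 := hpm z h1
      simp only [h2]; linarith)
    (fun z hz => by
      have h1 := hr z hz
      have h2 := hzm z (Set.disjoint_right.1 hdisj h1)
      have h3 := hpp z h1
      simp only [h2]; linarith)
    (fun z hz => by
      have := hg1 (Or.inr hz : z ∈ C₁)
      simp only [Pi.zero_apply] at this
      rw [this]; norm_num)
    (fun z hz => by
      have := hg2 (Or.inr hz : z ∈ C₂)
      simp only [Pi.one_apply] at this
      rw [this]; norm_num)
  have hzm' : z ∉ Wm := fun h => by
    have h2 := hzp z (Set.disjoint_left.1 hdisj h)
    have h3 := hpm z h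
    simp only [h2] at hz1; linarith
  have hzp' : z ∉ Wp := fun h => by
    have h2 := hzm z (Set.disjoint_right.1 hdisj h)
    have h3 := hpp z h
    simp only [h2] at hz1; linarith
  have hzZ : z ∈ Z := fun h => h.elim hzm' hzp'
  by_cases h : z ∈ O₁
  · have := hg1 (Or.inl ⟨hzZ, fun h' => h'.2 h⟩ : z ∈ C₁)
    simp only [Pi.zero_apply] at this
    rw [this] at hz2; norm_num at hz2
  · have := hg2 (Or.inl ⟨hzZ, h⟩ : z ∈ C₂)
    simp only [Pi.one_apply] at this
    rw [this] at hz2; norm_num at hz2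

end

section

/-! ### Global flows of bounded Lipschitz vector fields -/

section GlobalFlow

variable {E : Type*} [NormedAddCommGroup E] [NormedSpace ℝ E]

theorem exists_global_solution [CompleteSpace E] {f : E → E} {K : NNReal} (hf : LipschitzWith K f)
    {L : NNReal} (hL : ∀ x, ‖f x‖ ≤ L) (x : E) :
    ∃ α : ℝ → E, α 0 = x ∧ ∀ t, HasDerivAt α (f (α t)) t := by
  -- The global bound `L` on the field makes the radius `L (n + 1)` admissible on `[-(n+1), n+1]`;
  -- the local solutions are then glued by uniqueness.
  have hloc : ∀ n : ℕ, ∃ α : ℝ → E, α 0 = x ∧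
      ∀ t ∈ Ioo (-(n + 1 : ℝ)) (n + 1), HasDerivAt α (f (α t)) t := by
    intro n
    have h0 : (0 : ℝ) ∈ Icc (-(n + 1 : ℝ)) (n + 1) := ⟨by linarith [n.cast_nonneg (α := ℝ)],
      by linarith [n.cast_nonneg (α := ℝ)]⟩
    have hpl : IsPicardLindelof (fun _ => f) (⟨0, h0⟩ : Icc (-(n + 1 : ℝ)) (n + 1)) x
        (L * (n + 1)) 0 L K :=
      { lipschitzOnWith := fun _ _ => hf.lipschitzOnWith
        continuousOn := fun _ _ => continuousOn_const
        norm_le := fun _ _ y _ => hL y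
        mul_max_le := by simp }
    obtain ⟨α, hα0, hα⟩ := hpl.exists_eq_forall_mem_Icc_hasDerivWithinAt₀
    exact ⟨α, hα0, fun t ht => (hα t ⟨ht.1.le, ht.2.le⟩).hasDerivAt (Icc_mem_nhds ht.1 ht.2)⟩
  choose β hβ0 hβ using hloc
  have hmono : ∀ n m : ℕ, n ≤ m → ∀ t ∈ Ioo (-(n + 1 : ℝ)) (n + 1), β n t = β m t := by
    intro n m hnm t ht
    have hcast : (n : ℝ) ≤ m := by exact_mod_cast hnm
    have := ODE_solution_unique_of_mem_Ioo (v := fun _ => f) (s := fun _ => univ) (K := K)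
      (f := β n) (g := β m) (t₀ := 0) (a := -(n + 1 : ℝ)) (b := n + 1)
      (fun _ _ => hf.lipschitzOnWith)
      ⟨by linarith [n.cast_nonneg (α := ℝ)], by linarith [n.cast_nonneg (α := ℝ)]⟩
      (fun s hs => ⟨hβ n s hs, trivial⟩)
      (fun s hs => ⟨hβ m s ⟨by linarith [hs.1], by linarith [hs.2]⟩, trivial⟩)
      (by rw [hβ0, hβ0])
    exact this ht
  have hmem : ∀ t : ℝ, t ∈ Ioo (-((⌈|t|⌉₊ : ℕ) + 1 : ℝ)) ((⌈|t|⌉₊ : ℕ) + 1) := by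
    intro t
    have := abs_le.1 (Nat.le_ceil |t|)
    exact ⟨by linarith [this.1], by linarith [this.2]⟩
  have hglue : ∀ (n : ℕ) (t : ℝ), t ∈ Ioo (-(n + 1 : ℝ)) (n + 1) → β ⌈|t|⌉₊ t = β n t := by
    intro n t ht
    rcases le_total n ⌈|t|⌉₊ with h | h
    · exact (hmono _ _ h t ht).symm
    · exact hmono _ _ h t (hmem t)
  refine ⟨fun t => β ⌈|t|⌉₊ t, by simpa using hβ0 0, fun t => ?_⟩
  have h1 := hβ _ t (hmem t)
  refine h1.congr_of_eventuallyEq ?_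
  filter_upwards [Ioo_mem_nhds (hmem t).1 (hmem t).2] with s hs
  exact hglue _ s hs

lemma dist_solutions_le {f : E → E} {K : NNReal} (hf : LipschitzWith K f) {α β : ℝ → E}
    (hα : ∀ t, HasDerivAt α (f (α t)) t) (hβ : ∀ t, HasDerivAt β (f (β t)) t) (t : ℝ) :
    dist (α t) (β t) ≤ dist (α 0) (β 0) * Real.exp (K * |t|) := by
  have fwd : ∀ {f : E → E} (_ : LipschitzWith K f) {α β : ℝ → E}
      (_ : ∀ t, HasDerivAt α (f (α t)) t) (_ : ∀ t, HasDerivAt β (f (β t)) t) (t : ℝ), 0 ≤ t →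
      dist (α t) (β t) ≤ dist (α 0) (β 0) * Real.exp (K * t) := by
    intro f hf α β hα hβ t ht
    have := dist_le_of_trajectories_ODE (v := fun _ => f) (K := K) (f := α) (g := β) (a := 0)
      (b := t) (δ := dist (α 0) (β 0)) (fun _ => hf)
      (continuous_iff_continuousAt.2 fun t => (hα t).continuousAt).continuousOn
      (fun t _ => (hα t).hasDerivWithinAt)
      (continuous_iff_continuousAt.2 fun t => (hβ t).continuousAt).continuousOn
      (fun t _ => (hβ t).hasDerivWithinAt) le_rfl t ⟨ht, le_rfl⟩
    simpa using this
  rcases le_total 0 t with ht | ht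
  · rw [abs_of_nonneg ht]
    exact fwd hf hα hβ t ht
  · rw [abs_of_nonpos ht]
    have hrev : ∀ {γ : ℝ → E}, (∀ t, HasDerivAt γ (f (γ t)) t) →
        ∀ t, HasDerivAt (fun s => γ (-s)) (-f (γ (-t))) t := by
      intro γ hγ t
      have := (hγ (-t)).scomp t (hasDerivAt_neg t)
      simpa [Function.comp_def] using this
    have := fwd (f := fun x => -f x) hf.neg (hrev hα) (hrev hβ) (-t) (by linarith)
    simpa using this

/-- A global flow of a vector field, with at most exponential separation of trajectories. -/
structure IsFlow (f : E → E) (K : ℝ) (Φ : ℝ → E → E) : Prop where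
  zero : ∀ x, Φ 0 x = x
  hasDerivAt : ∀ x t, HasDerivAt (fun s => Φ s x) (f (Φ t x)) t
  dist_le : ∀ t x y, dist (Φ t x) (Φ t y) ≤ dist x y * Real.exp (K * |t|)
  add : ∀ s t x, Φ s (Φ t x) = Φ (s + t) x
  continuous : Continuous fun z : ℝ × E => Φ z.1 z.2

theorem exists_isFlow [CompleteSpace E] {f : E → E} {K : NNReal} (hf : LipschitzWith K f)
    {L : NNReal} (hL : ∀ x, ‖f x‖ ≤ L) : ∃ Φ : ℝ → E → E, IsFlow f K Φ := by
  choose α hα0 hα using exists_global_solution hf hL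
  have hdist : ∀ t x y, dist (α x t) (α y t) ≤ dist x y * Real.exp (K * |t|) := by
    intro t x y
    simpa [hα0] using dist_solutions_le hf (hα x) (hα y) t
  refine ⟨fun t x => α x t, hα0, hα, hdist, ?_, ?_⟩
  · intro s t x
    have h2 : ∀ s, HasDerivAt (fun s => α x (s + t)) (f (α x (s + t))) s := fun s =>
      (hα x (s + t)).comp_add_const s t
    have := dist_solutions_le hf (hα (α x t)) h2 s
    simpa [hα0] using this
  · rw [continuous_iff_continuousAt]
    rintro ⟨t₀, x₀⟩
    rw [ContinuousAt, tendsto_iff_dist_tendsto_zero]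
    have hlim : Tendsto (fun z : ℝ × E => dist z.2 x₀ * Real.exp (K * |z.1|)
        + dist (α x₀ z.1) (α x₀ t₀)) (𝓝 (t₀, x₀)) (𝓝 0) := by
      have hc : Continuous (α x₀) := continuous_iff_continuousAt.2 fun t => (hα x₀ t).continuousAt
      have : Continuous (fun z : ℝ × E => dist z.2 x₀ * Real.exp (K * |z.1|)
        + dist (α x₀ z.1) (α x₀ t₀)) := by fun_prop
      simpa using this.tendsto (t₀, x₀)
    refine squeeze_zero (fun _ => dist_nonneg) (fun z => ?_) hlim
    exact (dist_triangle _ (α x₀ z.1) _).trans (add_le_add (hdist _ _ _) le_rfl)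

end GlobalFlow

/-! ### The flow of the toy model -/

variable {N : ℕ}

lemma contDiff_mode (j : ℕ) : ContDiff ℝ 1 fun x : Phase N => mode x j := by
  by_cases h : 1 ≤ j ∧ j ≤ N
  · simp only [mode, h, and_self, dif_pos]
    fun_prop
  · simp only [mode, h, dif_neg, not_false_eq_true]
    fun_prop

lemma continuous_mode (j : ℕ) : Continuous fun x : Phase N => mode x j :=
  (contDiff_mode j).continuous

lemma contDiff_vectorField : ContDiff ℝ 1 (vectorField : Phase N → Phase N) := by
  rw [contDiff_piLp]
  intro i
  simp only [vectorField, modeVelocity]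
  have h : ∀ j, ContDiff ℝ 1 fun x : Phase N => (starRingEnd ℂ) (mode x j) := fun j =>
    Complex.conjCLE.contDiff.comp (contDiff_mode j)
  have h2 : ∀ j, ContDiff ℝ 1 fun x : Phase N => ((‖mode x j‖ ^ 2 : ℝ) : ℂ) := fun j =>
    Complex.ofRealCLM.contDiff.comp ((contDiff_mode j).norm_sq ℝ)
  have hm := fun j => contDiff_mode (N := N) j
  exact ((contDiff_const.mul (h2 _)).mul (hm _)).add
    ((contDiff_const.mul (h _)).mul (((hm _).pow 2).add ((hm _).pow 2)))

/-- The action `|b_k|²`. -/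
noncomputable def act (k : ℕ) (x : Phase N) : ℝ := ‖mode x k‖ ^ 2

/-- The bond `b_k conj(b_{k+1})`. -/
noncomputable def bond (k : ℕ) (x : Phase N) : ℂ := mode x k * (starRingEnd ℂ) (mode x (k + 1))

/-- The component of the bond that carries mass from mode `k + 1` to mode `k`. -/
noncomputable def bondU (k : ℕ) (x : Phase N) : ℝ := √3 * (bond k x).re + (bond k x).im

/-- The component of the bond that carries mass from mode `k` to mode `k + 1`. -/
noncomputable def bondV (k : ℕ) (x : Phase N) : ℝ := √3 * (bond k x).re - (bond k x).im

lemma act_nonneg (k : ℕ) (x : Phase N) : 0 ≤ act k x := by unfold act; positivity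

lemma continuous_act (k : ℕ) : Continuous (act k : Phase N → ℝ) :=
  (continuous_mode k).norm.pow 2

lemma continuous_bond (k : ℕ) : Continuous (bond k : Phase N → ℂ) :=
  (continuous_mode k).mul (Complex.continuous_conj.comp (continuous_mode (k + 1)))

lemma continuous_bondU (k : ℕ) : Continuous (bondU k : Phase N → ℝ) := by
  have h := continuous_bond (N := N) k
  exact (continuous_const.mul (Complex.continuous_re.comp h)).add (Complex.continuous_im.comp h)

lemma continuous_bondV (k : ℕ) : Continuous (bondV k : Phase N → ℝ) := by
  have h := continuous_bond (N := N) k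
  exact (continuous_const.mul (Complex.continuous_re.comp h)).sub (Complex.continuous_im.comp h)

lemma act_eq (k : ℕ) (x : Phase N) : act k x = (mode x k).re ^ 2 + (mode x k).im ^ 2 := by
  rw [act, Complex.sq_norm, Complex.normSq_apply]; ring

lemma mode_zero (x : Phase N) : mode x 0 = 0 := by simp [mode]

lemma mode_of_gt (x : Phase N) {k : ℕ} (h : N < k) : mode x k = 0 := by
  simp [mode, show ¬ k ≤ N by omega]

lemma mode_succ (x : Phase N) (i : Fin N) : mode x (i + 1) = x i := by
  simp [mode]

lemma norm_sq_eq_sum_act (x : Phase N) : ‖x‖ ^ 2 = ∑ k ∈ Finset.range N, act (k + 1) x := by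
  rw [EuclideanSpace.norm_sq_eq, ← Fin.sum_univ_eq_sum_range fun k => act (k + 1) x]
  simp [act, mode_succ]

lemma mode_vectorField (x : Phase N) (k : ℕ) : mode (vectorField x) k = modeVelocity x k := by
  by_cases h : 1 ≤ k ∧ k ≤ N
  · simp [mode, h, vectorField]
  · have : mode x k = 0 := by simp only [mode, h, dif_neg, not_false_eq_true]
    simp [modeVelocity, this]
    simp only [mode, h, dif_neg, not_false_eq_true]

lemma mode_smul (r : ℝ) (x : Phase N) (k : ℕ) : mode (r • x) k = r * mode x k := by
  by_cases h : 1 ≤ k ∧ k ≤ N <;> simp [mode, h]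

lemma hasDerivAt_mode {b : ℝ → Phase N} {v : Phase N} {t : ℝ} (hb : HasDerivAt b v t) (k : ℕ) :
    HasDerivAt (fun s => mode (b s) k) (mode v k) t := by
  by_cases h : 1 ≤ k ∧ k ≤ N
  · simp only [mode, h, and_self, dif_pos]
    exact (PiLp.proj 2 (𝕜 := ℝ) (fun _ : Fin N => ℂ) _).hasFDerivAt.comp_hasDerivAt t hb
  · simp only [mode, h, dif_neg, not_false_eq_true]
    exact hasDerivAt_const _ _

lemma hasDerivAt_re {z : ℝ → ℂ} {z' : ℂ} {t : ℝ} (h : HasDerivAt z z' t) :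
    HasDerivAt (fun s => (z s).re) z'.re t :=
  Complex.reCLM.hasFDerivAt.comp_hasDerivAt t h

lemma hasDerivAt_im {z : ℝ → ℂ} {z' : ℂ} {t : ℝ} (h : HasDerivAt z z' t) :
    HasDerivAt (fun s => (z s).im) z'.im t :=
  Complex.imCLM.hasFDerivAt.comp_hasDerivAt t h

lemma flux_eq (k : ℕ) (x : Phase N) : 2 / √3 * (bondU k x ^ 2 - bondV k x ^ 2) =
    8 * (bond k x).re * (bond k x).im := by
  have h3 : √3 ≠ 0 := by positivity
  unfold bondU bondV
  field_simp
  ring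

/-- The factor `χ` allows for a cut-off field. The right-hand side is `χ` times a difference of
consecutive fluxes, so the total mass telescopes and is conserved on and off the unit sphere. -/
lemma hasDerivAt_act_of_smul {b : ℝ → Phase N} {χ t : ℝ}
    (hb : HasDerivAt b (χ • vectorField (b t)) t) (k : ℕ) :
    HasDerivAt (fun s => act (k + 1) (b s))
      (χ * (8 * (bond (k + 1) (b t)).re * (bond (k + 1) (b t)).im
        - 8 * (bond k (b t)).re * (bond k (b t)).im)) t := by
  have h := hasDerivAt_mode hb (k + 1)
  have h1 := ((hasDerivAt_re h).fun_pow 2).fun_add ((hasDerivAt_im h).fun_pow 2)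
  simp only [act_eq]
  refine h1.congr_deriv ?_
  rw [mode_smul, mode_vectorField]
  simp only [bond, modeVelocity, Complex.sq_norm, Complex.normSq_apply, Nat.add_sub_cancel]
  simp [pow_two]
  ring

lemma hasDerivAt_norm_sq {b : ℝ → Phase N} {χ t : ℝ}
    (hb : HasDerivAt b (χ • vectorField (b t)) t) :
    HasDerivAt (fun s => ‖b s‖ ^ 2) 0 t := by
  have h := HasDerivAt.fun_sum (u := Finset.range N) fun k _ => hasDerivAt_act_of_smul hb k
  simp only [norm_sq_eq_sum_act]
  refine h.congr_deriv ?_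
  rw [← Finset.mul_sum, Finset.sum_range_sub fun k =>
    8 * (bond k (b t)).re * (bond k (b t)).im]
  simp [bond, mode_zero, mode_of_gt (b t) (Nat.lt_succ_self N)]

/-- A global flow that preserves the unit sphere and solves the toy model system there. -/
theorem exists_flow (N : ℕ) : ∃ (K : ℝ) (Φ : ℝ → Phase N → Phase N) (f : Phase N → Phase N),
    0 ≤ K ∧ IsFlow f K Φ ∧ (∀ t x, ‖x‖ = 1 → ‖Φ t x‖ = 1) ∧
      ∀ x, ‖x‖ = 1 → f x = vectorField x := by
  -- The cubic field is cut off outside the ball of radius 2, which makes it bounded and Lipschitz.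
  -- Mass conservation keeps orbits of the unit sphere where `χ = 1`.
  let χ : ContDiffBump (0 : Phase N) := ⟨1, 2, one_pos, one_lt_two⟩
  let f : Phase N → Phase N := fun x => χ x • vectorField x
  have hf : ContDiff ℝ 1 f := χ.contDiff.smul contDiff_vectorField
  have hs : HasCompactSupport f := χ.hasCompactSupport.smul_right
  obtain ⟨K, hK⟩ := ContDiff.lipschitzWith_of_hasCompactSupport hs hf one_ne_zero
  obtain ⟨L, hL⟩ := hs.exists_bound_of_continuous hf.continuous
  obtain ⟨Φ, hΦ⟩ := exists_isFlow hK (L := L.toNNReal)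
    fun x => (hL x).trans (Real.le_coe_toNNReal L)
  refine ⟨K, Φ, f, K.2, hΦ, fun t x hx => ?_, fun x hx => ?_⟩
  · have hd := fun t => hasDerivAt_norm_sq (hΦ.hasDerivAt x t)
    have := is_const_of_deriv_eq_zero (fun t => (hd t).differentiableAt)
      (fun t => (hd t).deriv) t 0
    rw [hΦ.zero, hx] at this
    nlinarith [norm_nonneg (Φ t x)]
  · have : χ x = 1 := χ.one_of_mem_closedBall (by simp [χ, hx])
    simp [f, this]

end

section

variable {N : ℕ}

/-! ### Evolution of actions and bonds -/

lemma hasDerivAt_act {b : ℝ → Phase N} {t : ℝ} (hb : HasDerivAt b (vectorField (b t)) t) (k : ℕ) :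
    HasDerivAt (fun s => act (k + 1) (b s))
      (2 / √3 * (bondU (k + 1) (b t) ^ 2 - bondV (k + 1) (b t) ^ 2)
        - 2 / √3 * (bondU k (b t) ^ 2 - bondV k (b t) ^ 2)) t := by
  rw [flux_eq, flux_eq]
  have := hasDerivAt_act_of_smul (χ := 1) (by simpa using hb) k
  simpa using this

lemma normSq_bond (k : ℕ) (x : Phase N) :
    (bond k x).re ^ 2 + (bond k x).im ^ 2 = act k x * act (k + 1) x := by
  rw [act, act, ← mul_pow, ← Complex.norm_conj (mode x (k + 1)), ← norm_mul, Complex.sq_norm,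
    Complex.normSq_apply]
  simp [bond, pow_two]

lemma bond_sq_sum (k : ℕ) (x : Phase N) :
    bondU k x ^ 2 + bondV k x ^ 2 = 6 * (bond k x).re ^ 2 + 2 * (bond k x).im ^ 2 := by
  have h3 : √3 ^ 2 = (3 : ℝ) := Real.sq_sqrt (by norm_num)
  unfold bondU bondV
  linear_combination 2 * (bond k x).re ^ 2 * h3

lemma two_mul_act_le (k : ℕ) (x : Phase N) :
    2 * (act k x * act (k + 1) x) ≤ bondU k x ^ 2 + bondV k x ^ 2 := by
  rw [bond_sq_sum, ← normSq_bond]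
  nlinarith [sq_nonneg (bond k x).re]

lemma bond_sq_le (k : ℕ) (x : Phase N) :
    bondU k x ^ 2 + bondV k x ^ 2 ≤ 6 * (act k x * act (k + 1) x) := by
  rw [bond_sq_sum, ← normSq_bond]
  nlinarith [sq_nonneg (bond k x).im]

lemma abs_flux_le (k : ℕ) (x : Phase N) :
    |2 / √3 * (bondU k x ^ 2 - bondV k x ^ 2)| ≤ 4 * (act k x * act (k + 1) x) := by
  rw [flux_eq, ← normSq_bond, abs_le]
  constructor <;>
  nlinarith [sq_nonneg ((bond k x).re + (bond k x).im), sq_nonneg ((bond k x).re - (bond k x).im)]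

lemma bondU_eq_zero {k : ℕ} {x : Phase N} (h : act (k + 1) x = 0) : bondU k x = 0 := by
  have h1 := bond_sq_le k x
  rw [h] at h1
  nlinarith [sq_nonneg (bondU k x), sq_nonneg (bondV k x)]

lemma bondV_eq_zero {k : ℕ} {x : Phase N} (h : act (k + 1) x = 0) : bondV k x = 0 := by
  have h1 := bond_sq_le k x
  rw [h] at h1
  nlinarith [sq_nonneg (bondU k x), sq_nonneg (bondV k x)]

/-- The influence of the modes `k` and `k + 3` on the bond between `k + 1` and `k + 2`. -/
noncomputable def bondForcing (k : ℕ) (x : Phase N) : ℂ :=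
  2 * Complex.I * ((starRingEnd ℂ) (mode x (k + 1)) * (starRingEnd ℂ) (mode x (k + 2))
      * mode x k ^ 2
    - mode x (k + 1) * mode x (k + 2) * (starRingEnd ℂ) (mode x (k + 3)) ^ 2)

lemma norm_bondForcing_le (k : ℕ) (x : Phase N) :
    (bondForcing k x).re ^ 2 + (bondForcing k x).im ^ 2
      ≤ 4 * (act (k + 1) x * act (k + 2) x) * (act k x + act (k + 3) x) ^ 2 := by
  have h1 : ‖bondForcing k x‖ ≤ 2 * (‖mode x (k + 1)‖ * ‖mode x (k + 2)‖)
      * (act k x + act (k + 3) x) := by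
    unfold bondForcing act
    rw [norm_mul, norm_mul, Complex.norm_I, mul_one, Complex.norm_ofNat]
    refine (mul_le_mul_of_nonneg_left (norm_sub_le _ _) (by norm_num)).trans (le_of_eq ?_)
    simp only [norm_mul, norm_pow, Complex.norm_conj]
    ring
  have h2 : (bondForcing k x).re ^ 2 + (bondForcing k x).im ^ 2 = ‖bondForcing k x‖ ^ 2 := by
    rw [Complex.sq_norm, Complex.normSq_apply]; ring
  rw [h2]
  refine (pow_le_pow_left₀ (norm_nonneg _) h1 2).trans (le_of_eq ?_)
  unfold act
  ring

lemma hasDerivAt_bond {b : ℝ → Phase N} {t : ℝ} (hb : HasDerivAt b (vectorField (b t)) t)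
    (k : ℕ) :
    HasDerivAt (fun s => bond (k + 1) (b s))
      (Complex.I * ((act (k + 2) (b t) : ℂ) - act (k + 1) (b t))
        * (bond (k + 1) (b t) + 2 * (starRingEnd ℂ) (bond (k + 1) (b t)))
        + bondForcing k (b t)) t := by
  have h1 := hasDerivAt_mode hb (k + 1)
  have h2 := Complex.conjCLE.toContinuousLinearMap.hasFDerivAt.comp_hasDerivAt t
    (hasDerivAt_mode hb (k + 2))
  have h := h1.mul h2
  refine h.congr_deriv ?_
  simp only [mode_vectorField]
  simp only [modeVelocity, bond, bondForcing, act, Nat.add_sub_cancel, Function.comp,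
    show k + 2 - 1 = k + 1 by omega, show k + 2 + 1 = k + 3 by omega,
    show k + 1 + 1 = k + 2 by omega]
  push_cast
  simp only [← Complex.mul_conj', Complex.conjCLE_apply, map_add,
    map_mul, map_neg, map_pow, Complex.conj_I, Complex.conj_conj, map_ofNat]
  ring

/-- The real-linear map `z ↦ i (z + 2 conj z)` sends `(re, im)` to `(im, 3 re)`. Its eigenvalues are
`±√3`, and `√3 re ± im` are the corresponding coordinates. The neighbouring modes enter only through
`bondForcing`, which is bounded relative to the bond itself. -/
lemma hasDerivAt_bondUV {b : ℝ → Phase N} {t : ℝ} (hb : HasDerivAt b (vectorField (b t)) t)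
    (k : ℕ) : ∃ e₁ e₂ : ℝ,
    HasDerivAt (fun s => bondU (k + 1) (b s))
      (√3 * (act (k + 2) (b t) - act (k + 1) (b t)) * bondU (k + 1) (b t) + e₁) t ∧
    HasDerivAt (fun s => bondV (k + 1) (b s))
      (-(√3 * (act (k + 2) (b t) - act (k + 1) (b t)) * bondV (k + 1) (b t)) + e₂) t ∧
    e₁ ^ 2 + e₂ ^ 2 ≤ 12 * (bondU (k + 1) (b t) ^ 2 + bondV (k + 1) (b t) ^ 2)
      * (act k (b t) + act (k + 3) (b t)) ^ 2 := by
  have h3 : √3 ^ 2 = (3 : ℝ) := Real.sq_sqrt (by norm_num)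
  have h := hasDerivAt_bond hb k
  refine ⟨√3 * (bondForcing k (b t)).re + (bondForcing k (b t)).im,
    √3 * (bondForcing k (b t)).re - (bondForcing k (b t)).im, ?_, ?_, ?_⟩
  · refine (((hasDerivAt_re h).const_mul √3).fun_add (hasDerivAt_im h)).congr_deriv ?_
    simp [bondU]
    linear_combination (-(act (k + 2) (b t) - act (k + 1) (b t)) * (bond (k + 1) (b t)).re) * h3
  · refine (((hasDerivAt_re h).const_mul √3).fun_sub (hasDerivAt_im h)).congr_deriv ?_
    simp [bondV]
    linear_combination ((act (k + 2) (b t) - act (k + 1) (b t)) * (bond (k + 1) (b t)).re) * h3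
  · have h1 := norm_bondForcing_le k (b t)
    have h2 := two_mul_act_le (k + 1) (b t)
    have h4 := mul_le_mul_of_nonneg_right h2 (sq_nonneg (act k (b t) + act (k + 3) (b t)))
    nlinarith [sq_nonneg (bondForcing k (b t)).im]

lemma norm_sq_eq_sum_act_of_lt (x : Phase N) {n : ℕ} (hn : N < n) :
    ‖x‖ ^ 2 = ∑ k ∈ Finset.range n, act k x := by
  obtain ⟨d, rfl⟩ := Nat.exists_eq_add_of_lt hn
  rw [norm_sq_eq_sum_act, show N + d + 1 = N + 1 + d by omega, Finset.sum_range_add,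
    Finset.sum_range_succ']
  have : ∑ i ∈ Finset.range d, act (N + 1 + i) x = 0 := Finset.sum_eq_zero fun i _ => by
    simp [act, mode_of_gt x (show N < N + 1 + i by omega)]
  rw [this]
  simp [act, mode_zero]

lemma sum_four_act_le (x : Phase N) (k : ℕ) :
    act k x + act (k + 1) x + act (k + 2) x + act (k + 3) x ≤ ‖x‖ ^ 2 := by
  rw [norm_sq_eq_sum_act_of_lt x (show N < N + k + 4 by omega)]
  have : ∑ j ∈ Finset.Ico k (k + 4), act j x ≤ ∑ j ∈ Finset.range (N + k + 4), act j x :=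
    Finset.sum_le_sum_of_subset_of_nonneg
      (fun j hj => by simp only [Finset.mem_Ico, Finset.mem_range] at *; omega)
      (fun _ _ _ => act_nonneg _ _)
  refine le_trans (le_of_eq ?_) this
  rw [Finset.sum_Ico_eq_sum_range]
  simp [Finset.sum_range_succ]

/-! ### Differential inequalities -/

lemma le_mul_exp_of_deriv_le {f : ℝ → ℝ} {a s T : ℝ} (hsT : s ≤ T)
    (hf : ∀ t, ∃ d, HasDerivAt f d t ∧ (t ∈ Ioo s T → d ≤ a * f t)) :
    f T ≤ f s * Real.exp (a * (T - s)) := by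
  choose f' hf h using hf
  have hg : ∀ t, HasDerivAt (fun t => f t * Real.exp (-a * (t - s)))
      (f' t * Real.exp (-a * (t - s)) + f t * (Real.exp (-a * (t - s)) * (-a * 1))) t := fun t =>
    (hf t).fun_mul ((((hasDerivAt_id t).sub_const s).const_mul (-a)).exp)
  have hanti : AntitoneOn (fun t => f t * Real.exp (-a * (t - s))) (Icc s T) := by
    refine antitoneOn_of_deriv_nonpos (convex_Icc s T)
      (fun t _ => (hg t).continuousAt.continuousWithinAt)
      (fun t _ => (hg t).differentiableAt.differentiableWithinAt) fun t ht => ?_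
    rw [interior_Icc] at ht
    rw [(hg t).deriv]
    nlinarith [h t ht, Real.exp_pos (-a * (t - s))]
  have := hanti (left_mem_Icc.2 hsT) (right_mem_Icc.2 hsT) hsT
  simp only [sub_self, mul_zero, Real.exp_zero, mul_one] at this
  calc f T = f T * Real.exp (-a * (T - s)) * Real.exp (a * (T - s)) := by
        rw [mul_assoc, ← Real.exp_add]; simp
    _ ≤ _ := mul_le_mul_of_nonneg_right this (Real.exp_pos _).le

lemma mul_exp_le_of_le_deriv {f : ℝ → ℝ} {a s T : ℝ} (hsT : s ≤ T)
    (hf : ∀ t, ∃ d, HasDerivAt f d t ∧ (t ∈ Ioo s T → a * f t ≤ d)) :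
    f s * Real.exp (a * (T - s)) ≤ f T := by
  have := le_mul_exp_of_deriv_le (f := fun t => -f t) (a := a) hsT fun t => by
    obtain ⟨d, hd, h⟩ := hf t
    exact ⟨-d, hd.fun_neg, fun ht => by linarith [h ht]⟩
  linarith

lemma le_add_of_deriv_le {f : ℝ → ℝ} {a s T : ℝ} (hsT : s ≤ T)
    (hf : ∀ t, ∃ d, HasDerivAt f d t ∧ (t ∈ Ioo s T → d ≤ a)) : f T ≤ f s + a * (T - s) := by
  choose f' hf h using hf
  have := (convex_Icc s T).image_sub_le_mul_sub_of_deriv_le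
    (fun t _ => (hf t).continuousAt.continuousWithinAt)
    (fun t _ => (hf t).differentiableAt.differentiableWithinAt) (C := a)
    (fun t ht => by rw [interior_Icc] at ht; rw [(hf t).deriv]; exact h t ht)
    s (left_mem_Icc.2 hsT) T (right_mem_Icc.2 hsT) hsT
  linarith

lemma le_of_deriv_nonneg {f : ℝ → ℝ} {s T : ℝ} (hsT : s ≤ T)
    (hf : ∀ t, ∃ d, HasDerivAt f d t ∧ (t ∈ Ioo s T → 0 ≤ d)) : f s ≤ f T := by
  have := le_add_of_deriv_le (f := fun t => -f t) (a := 0) hsT fun t => by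
    obtain ⟨d, hd, h⟩ := hf t
    exact ⟨-d, hd.fun_neg, fun ht => by linarith [h ht]⟩
  linarith

lemma abs_sub_le_of_abs_deriv_le {f : ℝ → ℝ} {a s T : ℝ} (hsT : s ≤ T)
    (hf : ∀ t, ∃ d, HasDerivAt f d t ∧ (t ∈ Ioo s T → |d| ≤ a)) :
    |f T - f s| ≤ a * (T - s) := by
  have h1 := le_add_of_deriv_le (f := f) (a := a) hsT fun t => by
    obtain ⟨d, hd, h⟩ := hf t
    exact ⟨d, hd, fun ht => (abs_le.1 (h ht)).2⟩
  have h2 := le_add_of_deriv_le (f := fun t => -f t) (a := a) hsT fun t => by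
    obtain ⟨d, hd, h⟩ := hf t
    exact ⟨-d, hd.fun_neg, fun ht => by linarith [(abs_le.1 (h ht)).1]⟩
  rw [abs_le]
  constructor <;> linarith

/-- A continuous function that stays above a level as long as it was above it before never
reaches that level. -/
lemma forall_lt_of_bootstrap {f : ℝ → ℝ} (hf : Continuous f) {c s T : ℝ}
    (h : ∀ t ∈ Icc s T, (∀ r ∈ Ico s t, c < f r) → c < f t) : ∀ t ∈ Icc s T, c < f t := by
  by_contra! hne
  obtain ⟨t₀, ht₀, hft₀⟩ := hne
  let B : Set ℝ := Icc s T ∩ {t | f t ≤ c}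
  have hB : IsCompact B := isCompact_Icc.inter_right (isClosed_le hf continuous_const)
  obtain ⟨t, ht, hmin⟩ := hB.exists_isLeast ⟨t₀, ht₀, hft₀⟩
  have := h t ht.1 fun r hr => by
    by_contra! hr'
    have := hmin ⟨⟨hr.1, hr.2.le.trans ht.1.2⟩, hr'⟩
    linarith [hr.2]
  exact absurd ht.2 (not_le.2 this)

lemma forall_pos_of_ne_zero {f : ℝ → ℝ} (hf : Continuous f) {s T : ℝ} (hs : 0 < f s)
    (h : ∀ t ∈ Icc s T, f t ≠ 0) : ∀ t ∈ Icc s T, 0 < f t := by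
  intro t ht
  by_contra! hle
  obtain ⟨r, hr, hr0⟩ := intermediate_value_Icc' ht.1 hf.continuousOn ⟨hle, hs.le⟩
  exact h r ⟨hr.1, hr.2.trans ht.2⟩ hr0

end

section

/-! ### Perturbed hyperbolic pairs -/

/-- `f` is expanded and `g` contracted at the rate `μ`, up to a relative error `√12 X`. -/
structure HyperbolicPair (f g μ X : ℝ → ℝ) : Prop where
  nonneg : ∀ t, 0 ≤ X t
  deriv : ∀ t, ∃ e₁ e₂ : ℝ, HasDerivAt f (μ t * f t + e₁) t ∧ HasDerivAt g (-(μ t * g t) + e₂) t ∧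
    e₁ ^ 2 + e₂ ^ 2 ≤ 12 * (f t ^ 2 + g t ^ 2) * X t ^ 2

/-- Cauchy–Schwarz, with `√12` rounded up to 4. -/
lemma abs_mul_add_mul_le {a b e₁ e₂ G X : ℝ} (hG : a ^ 2 + b ^ 2 = G) (hX : 0 ≤ X)
    (h : e₁ ^ 2 + e₂ ^ 2 ≤ 12 * G * X ^ 2) : |a * e₁ + b * e₂| ≤ 4 * G * X := by
  have hG0 : 0 ≤ G := by rw [← hG]; positivity
  refine abs_le_of_sq_le_sq ?_ (by positivity)
  have h1 : (a * e₁ + b * e₂) ^ 2 ≤ G * (e₁ ^ 2 + e₂ ^ 2) := by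
    rw [← hG]; nlinarith [sq_nonneg (a * e₂ - b * e₁)]
  have h2 := mul_le_mul_of_nonneg_left h hG0
  nlinarith [sq_nonneg (G * X)]

namespace HyperbolicPair

variable {f g μ X : ℝ → ℝ}

lemma swap (h : HyperbolicPair f g μ X) : HyperbolicPair g f (fun t => -μ t) X where
  nonneg := h.nonneg
  deriv t := by
    obtain ⟨e₁, e₂, h1, h2, h3⟩ := h.deriv t
    exact ⟨e₂, e₁, by simpa using h2, by simpa using h1, by linarith⟩

lemma neg_left (h : HyperbolicPair f g μ X) : HyperbolicPair (fun t => -f t) g μ X where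
  nonneg := h.nonneg
  deriv t := by
    obtain ⟨e₁, e₂, h1, h2, h3⟩ := h.deriv t
    exact ⟨-e₁, e₂, h1.fun_neg.congr_deriv (by ring), h2, by simpa using h3⟩

lemma continuous_left (h : HyperbolicPair f g μ X) : Continuous f :=
  continuous_iff_continuousAt.2 fun t => by
    obtain ⟨_, _, h1, _⟩ := h.deriv t
    exact h1.continuousAt

lemma continuous_right (h : HyperbolicPair f g μ X) : Continuous g := h.swap.continuous_left

lemma hasDerivAt_sq_sub (h : HyperbolicPair f g μ X) (t : ℝ) :
    ∃ d, HasDerivAt (fun t => f t ^ 2 - g t ^ 2) d t ∧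
      2 * (μ t - 4 * X t) * (f t ^ 2 + g t ^ 2) ≤ d := by
  obtain ⟨e₁, e₂, h1, h2, h3⟩ := h.deriv t
  refine ⟨_, (h1.fun_pow 2).fun_sub (h2.fun_pow 2), ?_⟩
  have := abs_mul_add_mul_le (a := f t) (b := -g t) (by ring_nf) (h.nonneg t) h3
  norm_num
  linarith [(abs_le.1 this).1]

lemma hasDerivAt_sq_add (h : HyperbolicPair f g μ X) (t : ℝ) :
    ∃ d, HasDerivAt (fun t => f t ^ 2 + g t ^ 2) d t ∧
      d ≤ 2 * (|μ t| + 4 * X t) * (f t ^ 2 + g t ^ 2) := by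
  obtain ⟨e₁, e₂, h1, h2, h3⟩ := h.deriv t
  refine ⟨_, (h1.fun_pow 2).fun_add (h2.fun_pow 2), ?_⟩
  have := abs_mul_add_mul_le (a := f t) (b := g t) rfl (h.nonneg t) h3
  norm_num
  nlinarith [(abs_le.1 this).2, le_abs_self (μ t), neg_abs_le (μ t), sq_nonneg (f t),
    sq_nonneg (g t)]

/-- The rates `μ` and `-μ` cancel, so `f g` is an adiabatic invariant. Its sign remembers on which
side of the heteroclinic connection an orbit lies, from one circle to the next. -/
lemma hasDerivAt_mul (h : HyperbolicPair f g μ X) (t : ℝ) :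
    ∃ d, HasDerivAt (fun t => f t * g t) d t ∧ |d| ≤ 4 * (f t ^ 2 + g t ^ 2) * X t := by
  obtain ⟨e₁, e₂, h1, h2, h3⟩ := h.deriv t
  refine ⟨_, h1.fun_mul h2, ?_⟩
  have := abs_mul_add_mul_le (a := g t) (b := f t) (by ring_nf) (h.nonneg t) h3
  convert this using 2
  ring

/-- In the cone `g² ≤ 2 f²` the error satisfies `e₁² ≤ 36 f² X²`; hence the constant 6. -/
lemma hasDerivAt_sq (h : HyperbolicPair f g μ X) (t : ℝ) :
    ∃ d, HasDerivAt (fun t => f t ^ 2) d t ∧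
      (g t ^ 2 ≤ 2 * f t ^ 2 → 2 * (μ t - 6 * X t) * f t ^ 2 ≤ d ∧
        d ≤ 2 * (μ t + 6 * X t) * f t ^ 2) := by
  obtain ⟨e₁, e₂, h1, h2, h3⟩ := h.deriv t
  refine ⟨_, h1.fun_pow 2, fun hg => ?_⟩
  have hX := h.nonneg t
  have h4 : |f t * e₁| ≤ 6 * X t * f t ^ 2 := by
    refine abs_le_of_sq_le_sq ?_ (by positivity)
    have : e₁ ^ 2 ≤ 36 * f t ^ 2 * X t ^ 2 := by nlinarith [sq_nonneg e₂, sq_nonneg (X t)]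
    nlinarith [sq_nonneg (f t)]
  norm_num
  constructor <;> linarith [(abs_le.1 h4).1, (abs_le.1 h4).2]

/-- The cone `|g| ≤ |f|` is forward invariant as long as the error is dominated by the rate. -/
lemma sq_sub_sq_le (h : HyperbolicPair f g μ X) {s T : ℝ} (hsT : s ≤ T)
    (hμ : ∀ t ∈ Ioo s T, 4 * X t ≤ μ t) : f s ^ 2 - g s ^ 2 ≤ f T ^ 2 - g T ^ 2 := by
  refine le_of_deriv_nonneg (f := fun t => f t ^ 2 - g t ^ 2) hsT fun t => ?_
  obtain ⟨d, hd, hd'⟩ := h.hasDerivAt_sq_sub t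
  refine ⟨d, hd, fun ht => le_trans ?_ hd'⟩
  have := hμ t ht
  have : 0 ≤ μ t - 4 * X t := by linarith
  positivity

/-- In the open cone `f` cannot vanish, so the half of the cone that contains the orbit is preserved
as well. -/
lemma abs_lt_of_abs_lt (h : HyperbolicPair f g μ X) {s T : ℝ} (hsT : s ≤ T)
    (hμ : ∀ t ∈ Ioo s T, 4 * X t ≤ μ t) (hs : |g s| < f s) : |g T| < f T := by
  have hsq : ∀ t ∈ Icc s T, g t ^ 2 < f t ^ 2 := by
    intro t ht
    have h1 := h.sq_sub_sq_le ht.1 fun r hr => hμ r ⟨hr.1, hr.2.trans_le ht.2⟩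
    have h2 : g s ^ 2 < f s ^ 2 := sq_lt_sq' (by linarith [(abs_lt.1 hs).1]) (abs_lt.1 hs).2
    linarith
  have hpos := forall_pos_of_ne_zero h.continuous_left ((abs_nonneg _).trans_lt hs)
    (T := T) fun t ht h0 => by
      have := hsq t ht
      rw [h0] at this
      nlinarith [sq_nonneg (g t)]
  exact abs_lt_of_sq_lt_sq (hsq T ⟨hsT, le_rfl⟩) (hpos T ⟨hsT, le_rfl⟩).le

end HyperbolicPair

end

section

/-! ### Passage near a circle -/

/-- The quantities that govern the passage from one circle to the next one: `B, A, M, J` are the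
actions of four consecutive modes, `u, v` the components of the bond between the second and the
third mode, and `p, q` those of the bond between the third and the fourth mode, which is the last
one. -/
structure Passage (A B M J u v p q : ℝ → ℝ) : Prop where
  A_nonneg : ∀ t, 0 ≤ A t
  B_nonneg : ∀ t, 0 ≤ B t
  M_nonneg : ∀ t, 0 ≤ M t
  J_nonneg : ∀ t, 0 ≤ J t
  mass : ∀ t, A t + B t + M t + J t ≤ 1
  deriv_A : ∀ t, ∃ d, HasDerivAt A d t ∧ |d| ≤ 4 * A t * (B t + M t)
  deriv_M : ∀ t, HasDerivAt M (2 / √3 * (p t ^ 2 - q t ^ 2) - 2 / √3 * (u t ^ 2 - v t ^ 2)) t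
  deriv_J : ∀ t, HasDerivAt J (-(2 / √3 * (p t ^ 2 - q t ^ 2))) t
  left : HyperbolicPair u v (fun t => √3 * (M t - A t)) (fun t => B t + J t)
  right : HyperbolicPair p q (fun t => √3 * (J t - M t)) A
  left_ge : ∀ t, 2 * (A t * M t) ≤ u t ^ 2 + v t ^ 2
  left_le : ∀ t, u t ^ 2 + v t ^ 2 ≤ 6 * (A t * M t)
  right_ge : ∀ t, 2 * (M t * J t) ≤ p t ^ 2 + q t ^ 2
  right_le : ∀ t, p t ^ 2 + q t ^ 2 ≤ 6 * (M t * J t)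

lemma sqrt_three_bounds : 1.73 < √3 ∧ √3 < 1.74 := by
  constructor
  · exact Real.lt_sqrt_of_sq_lt (by norm_num)
  · rw [Real.sqrt_lt' (by norm_num)]; norm_num

lemma two_div_sqrt_three_bounds : 1.1 < 2 / √3 ∧ 2 / √3 < 1.2 := by
  obtain ⟨h1, h2⟩ := sqrt_three_bounds
  constructor
  · rw [lt_div_iff₀ (by linarith)]; linarith
  · rw [div_lt_iff₀ (by linarith)]; linarith

namespace Passage

variable {A B M J u v p q : ℝ → ℝ}

lemma continuous_M (h : Passage A B M J u v p q) : Continuous M :=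
  continuous_iff_continuousAt.2 fun t => (h.deriv_M t).continuousAt

lemma continuous_J (h : Passage A B M J u v p q) : Continuous J :=
  continuous_iff_continuousAt.2 fun t => (h.deriv_J t).continuousAt

/-- Only `p²` enters the mass equations. This reflection lets both ends of a path be treated by one
exit lemma. -/
lemma neg_p (h : Passage A B M J u v p q) : Passage A B M J u v (fun t => -p t) q :=
  { h with
    deriv_M := by simpa using h.deriv_M
    deriv_J := by simpa using h.deriv_J
    right := h.right.neg_left
    right_ge := by simpa using h.right_ge
    right_le := by simpa using h.right_le }

/-- The expanding cone of the left bond is forward invariant while the middle mode dominates. -/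
lemma abs_v_lt_u (h : Passage A B M J u v p q) {s T : ℝ} (hsT : s ≤ T)
    (hM : ∀ t ∈ Ioo s T, 99 / 100 < M t) (hs : |v s| < u s) : |v T| < u T := by
  refine h.left.abs_lt_of_abs_lt hsT (fun t ht => ?_) hs
  have := sqrt_three_bounds.1
  have := hM t ht
  have := h.mass t
  have := h.A_nonneg t
  have := h.B_nonneg t
  have := h.J_nonneg t
  nlinarith

lemma abs_v_lt_neg_u (h : Passage A B M J u v p q) {s T : ℝ} (hsT : s ≤ T)
    (hM : ∀ t ∈ Ioo s T, 99 / 100 < M t) (hs : |v s| < -u s) : |v T| < -u T := by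
  refine h.left.neg_left.abs_lt_of_abs_lt hsT (fun t ht => ?_) hs
  have := sqrt_three_bounds.1
  have := hM t ht
  have := h.mass t
  have := h.A_nonneg t
  have := h.B_nonneg t
  have := h.J_nonneg t
  nlinarith

/-- `J` varies at a relative rate of at most 8, so its value at the time of insertion controls it at
all earlier times. -/
lemma J_le_of_later (h : Passage A B M J u v p q) {s T : ℝ} (hsT : s ≤ T) :
    J s ≤ J T * Real.exp (8 * (T - s)) := by
  have := mul_exp_le_of_le_deriv (f := J) (a := -8) hsT fun t => ⟨_, h.deriv_J t, fun _ => by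
    have h1 := h.right_le t
    have h2 := two_div_sqrt_three_bounds
    have h3 := h.mass t
    have h4 := h.A_nonneg t
    have h5 := h.B_nonneg t
    have h6 := h.J_nonneg t
    have h7 := h.M_nonneg t
    have h8 : M t * J t ≤ 1 * J t := mul_le_mul_of_nonneg_right (by linarith) h6
    have h9 : 2 / √3 * (p t ^ 2 - q t ^ 2) ≤ 1.2 * (p t ^ 2 + q t ^ 2) := by
      nlinarith [sq_nonneg (p t), sq_nonneg (q t)]
    linarith⟩
  calc J s = J s * Real.exp (-8 * (T - s)) * Real.exp (8 * (T - s)) := by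
        rw [mul_assoc, ← Real.exp_add]; simp
    _ ≤ _ := mul_le_mul_of_nonneg_right this (Real.exp_pos _).le

/-- The rate of the right bond is at most `√3` in modulus, and its forcing is `A < ρ`. -/
lemma right_growth (h : Passage A B M J u v p q) {s T ρ : ℝ} (hsT : s ≤ T)
    (hM : ∀ t ∈ Ioo s T, 1 - ρ < M t) :
    p T ^ 2 + q T ^ 2 ≤ (p s ^ 2 + q s ^ 2) * Real.exp ((2 * √3 + 8 * ρ) * (T - s)) := by
  refine le_mul_exp_of_deriv_le (f := fun t => p t ^ 2 + q t ^ 2) hsT fun t => ?_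
  obtain ⟨d, hd, hd'⟩ := h.right.hasDerivAt_sq_add t
  refine ⟨d, hd, fun ht => hd'.trans ?_⟩
  refine mul_le_mul_of_nonneg_right ?_ (by positivity)
  have h3 := h.mass t
  have h4 := h.A_nonneg t
  have h5 := h.B_nonneg t
  have h6 := h.J_nonneg t
  have h7 := h.M_nonneg t
  have h8 := hM t ht
  have h9 : |√3 * (J t - M t)| ≤ √3 * 1 := by
    rw [abs_mul, abs_of_pos (by positivity : 0 < √3)]
    refine mul_le_mul_of_nonneg_left ?_ (by positivity)
    rw [abs_le]
    constructor <;> linarith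
  linarith

/-- If the left bond never enters the expanding cone, the orbit stays near the circle. -/
lemma forall_M_gt (h : Passage A B M J u v p q) {ρ T₀ T₁ : ℝ} (hT₀ : 0 ≤ T₀)
    (hρ : 0 < ρ) (hρ1 : ρ ≤ 1 / 100) (hM0 : 1 - ρ / 4 ≤ M 0)
    (hJ : J T₀ * Real.exp (8 * T₀) ≤ ρ / 4)
    (hQ : (p T₀ ^ 2 + q T₀ ^ 2) * Real.exp ((2 * √3 + 8 * ρ) * (T₁ - T₀)) ≤ ρ / 4)
    (hcone : ∀ t ∈ Icc 0 T₁, (∀ r ∈ Icc 0 t, 1 - ρ < M r) → u t ^ 2 ≤ v t ^ 2) :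
    ∀ t ∈ Icc 0 T₁, 1 - ρ < M t := by
  refine forall_lt_of_bootstrap h.continuous_M fun t ht hlt => ?_
  -- Before `T₀` the last action is compared backwards with its value at `T₀`. After `T₀` it is
  -- bounded through the growth of the right bond.
  have hJt : J t ≤ ρ / 3 := by
    rcases le_total t T₀ with h0 | h0
    · have h1 := h.J_le_of_later h0
      have h2 : Real.exp (8 * (T₀ - t)) ≤ Real.exp (8 * T₀) :=
        Real.exp_le_exp.2 (by linarith [ht.1])
      have h3 := mul_le_mul_of_nonneg_left h2 (h.J_nonneg T₀)
      linarith
    · rcases eq_or_lt_of_le h0 with rfl | h0'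
      · have h1 := h.J_le_of_later (le_refl T₀)
        have h2 : Real.exp (8 * (T₀ - T₀)) ≤ Real.exp (8 * T₀) :=
          Real.exp_le_exp.2 (by linarith [ht.1])
        have h3 := mul_le_mul_of_nonneg_left h2 (h.J_nonneg T₀)
        linarith
      have h1 := h.right_growth h0 fun r hr => hlt r ⟨by linarith [hr.1], hr.2⟩
      have h2 : Real.exp ((2 * √3 + 8 * ρ) * (t - T₀)) ≤
          Real.exp ((2 * √3 + 8 * ρ) * (T₁ - T₀)) :=
        Real.exp_le_exp.2 (mul_le_mul_of_nonneg_left (by linarith [ht.2]) (by positivity))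
      have h3 := mul_le_mul_of_nonneg_left h2 (by positivity : 0 ≤ p T₀ ^ 2 + q T₀ ^ 2)
      have h4 := h.right_ge t
      have h5 : 1 - ρ ≤ M t := by
        refine ge_of_tendsto (h.continuous_M.continuousWithinAt (s := Iio t) (x := t)) ?_
        filter_upwards [Ioo_mem_nhdsLT (show (0 : ℝ) < t by linarith)] with r hr
        exact (hlt r ⟨hr.1.le, hr.2⟩).le
      nlinarith [h.J_nonneg t]
  -- In the contracting cone the flux through the left bond points forward, so the mass outside the
  -- last two modes cannot increase.
  have hS : 1 - M t - J t ≤ 1 - M 0 - J 0 := by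
    have := le_add_of_deriv_le (f := fun t => 1 - M t - J t) (a := 0) ht.1 fun r =>
      ⟨_, ((h.deriv_M r).const_sub 1).fun_sub (h.deriv_J r), fun hr => by
        have := hcone r ⟨hr.1.le, hr.2.le.trans ht.2⟩ fun r' hr' =>
          hlt r' ⟨hr'.1, hr'.2.trans_lt hr.2⟩
        have h2 := two_div_sqrt_three_bounds.1
        nlinarith⟩
    linarith
  linarith [h.J_nonneg 0]

/-- Exponential decay of the second action while the left bond stays in the contracting cone. -/
lemma A_decay (h : Passage A B M J u v p q) {ρ T : ℝ} (hρ1 : ρ ≤ 1 / 100)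
    (hM : ∀ t ∈ Icc 0 T, 1 - ρ < M t) (hcone : ∀ t ∈ Icc 0 T, u t ^ 2 < 2 * v t ^ 2) :
    ∀ t ∈ Icc 0 T, A t ≤ 2 * Real.exp (-((2 * √3 - 20 * ρ) * t)) := by
  intro t ht
  have hsmall : ∀ r ∈ Icc 0 T, A r < ρ ∧ B r + J r < ρ ∧ 1 - 2 * ρ < M r - A r := by
    intro r hr
    have := hM r hr
    have := h.mass r
    have := h.A_nonneg r
    have := h.B_nonneg r
    have := h.J_nonneg r
    refine ⟨by linarith, by linarith, by linarith⟩
  have h1 := le_mul_exp_of_deriv_le (f := fun t => v t ^ 2) (a := -(2 * √3 - 20 * ρ)) ht.1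
    fun r => by
      obtain ⟨d, hd, hd'⟩ := h.left.swap.hasDerivAt_sq r
      refine ⟨d, hd, fun hr => ?_⟩
      have hr' : r ∈ Icc 0 T := ⟨hr.1.le, hr.2.le.trans ht.2⟩
      refine (hd' (hcone r hr').le).2.trans (mul_le_mul_of_nonneg_right ?_ (sq_nonneg _))
      obtain ⟨h1, h2, h3⟩ := hsmall r hr'
      have := sqrt_three_bounds
      nlinarith [h.A_nonneg r]
  rw [sub_zero, neg_mul] at h1
  have h0 : (0 : ℝ) ∈ Icc 0 T := ⟨le_rfl, ht.1.trans ht.2⟩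
  have hv0 : v 0 ^ 2 ≤ 1 := by
    have := h.left_le 0
    have := hsmall 0 h0
    have := h.A_nonneg 0
    have := h.mass 0
    have := h.B_nonneg 0
    have := h.J_nonneg 0
    have : A 0 * M 0 ≤ A 0 * 1 := mul_le_mul_of_nonneg_left (by linarith) (h.A_nonneg 0)
    nlinarith [sq_nonneg (u 0)]
  have h2 := h.left_ge t
  have h3 := hcone t ht
  have h4 := hM t ht
  have h5 := h.A_nonneg t
  have h6 : v t ^ 2 ≤ Real.exp (-((2 * √3 - 20 * ρ) * t)) :=
    h1.trans (mul_le_of_le_one_left (Real.exp_pos _).le hv0)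
  nlinarith

/-- Behaviour of the right bond while the middle mode dominates. -/
lemma right_bond_estimates (h : Passage A B M J u v p q) {ρ T₀ T₁ : ℝ} (hT₀ : 0 ≤ T₀)
    (hT : T₀ ≤ T₁) (hρ : 0 < ρ) (hρ1 : ρ ≤ 1 / 100) (hM : ∀ t ∈ Icc 0 T₁, 1 - ρ < M t)
    (hA : ∀ t ∈ Icc 0 T₁, A t ≤ 2 * Real.exp (-((2 * √3 - 20 * ρ) * t)))
    (hJ0 : ∀ t, 0 < J t) (hq : 0 < q T₀) (hpq : p T₀ ^ 2 ≤ q T₀ ^ 2)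
    (hnum : 16 * (T₁ - T₀) * Real.exp (-((2 * √3 - 20 * ρ) * T₀) + 28 * ρ * (T₁ - T₀)) ≤ 1 / 4) :
    0 < q T₁ ∧ p T₁ ^ 2 ≤ q T₁ ^ 2 ∧
      q T₀ ^ 2 * Real.exp ((2 * √3 - 20 * ρ) * (T₁ - T₀)) ≤ q T₁ ^ 2 ∧
      |p T₁ * q T₁ - p T₀ * q T₀| ≤ q T₀ ^ 2 / 4 := by
  have hmem : ∀ t ∈ Icc T₀ T₁, t ∈ Icc 0 T₁ := fun t ht => ⟨hT₀.trans ht.1, ht.2⟩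
  have hsmall : ∀ t ∈ Icc T₀ T₁, A t < ρ ∧ 1 - 2 * ρ < M t - J t := by
    intro t ht
    have := hM t (hmem t ht)
    have := h.mass t
    have := h.A_nonneg t
    have := h.B_nonneg t
    have := h.J_nonneg t
    exact ⟨by linarith, by linarith⟩
  have hcone : ∀ t ∈ Icc T₀ T₁, p t ^ 2 ≤ q t ^ 2 := by
    intro t ht
    have := h.right.swap.sq_sub_sq_le ht.1 fun r hr => by
      obtain ⟨h1, h2⟩ := hsmall r ⟨hr.1.le, hr.2.le.trans ht.2⟩
      have := sqrt_three_bounds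
      nlinarith
    linarith
  have hqpos : ∀ t ∈ Icc T₀ T₁, 0 < q t := forall_pos_of_ne_zero h.right.continuous_right hq
    fun t ht h0 => by
      have h1 := hcone t ht
      have h2 := h.right_ge t
      have h3 : 0 < M t * J t := mul_pos (by linarith [hM t (hmem t ht)]) (hJ0 t)
      rw [h0] at h1 h2
      nlinarith
  have hend : T₁ ∈ Icc T₀ T₁ := ⟨hT, le_rfl⟩
  refine ⟨hqpos T₁ hend, hcone T₁ hend, ?_, ?_⟩
  · refine mul_exp_le_of_le_deriv (f := fun t => q t ^ 2) hT fun t => ?_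
    obtain ⟨d, hd, hd'⟩ := h.right.swap.hasDerivAt_sq t
    refine ⟨d, hd, fun ht => ?_⟩
    have ht' : t ∈ Icc T₀ T₁ := ⟨ht.1.le, ht.2.le⟩
    refine le_trans (mul_le_mul_of_nonneg_right ?_ (sq_nonneg _))
      (hd' (by nlinarith [hcone t ht', sq_nonneg (q t)])).1
    obtain ⟨h1, h2⟩ := hsmall t ht'
    have := sqrt_three_bounds
    nlinarith
  · have hder := abs_sub_le_of_abs_deriv_le (f := fun t => p t * q t) hT
      (a := q T₀ ^ 2 * (16 * Real.exp (-((2 * √3 - 20 * ρ) * T₀) + 28 * ρ * (T₁ - T₀))))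
      fun t => by
        obtain ⟨d, hd, hd'⟩ := h.right.hasDerivAt_mul t
        refine ⟨d, hd, fun ht => hd'.trans ?_⟩
        have ht' : t ∈ Icc T₀ T₁ := ⟨ht.1.le, ht.2.le⟩
        have h1 := h.right_growth ht.1.le fun r hr =>
          hM r (hmem r ⟨hr.1.le, hr.2.le.trans ht.2.le⟩)
        have h2 := hA t (hmem t ht')
        -- The growth of `p² + q²` nearly cancels the decay of `A`. What remains is the decay over
        -- `[0, T₀]`, up to the mismatch `28 ρ = 8 ρ + 20 ρ` of the two exponents.
        have h3 : (p t ^ 2 + q t ^ 2) ≤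
            2 * q T₀ ^ 2 * Real.exp ((2 * √3 + 8 * ρ) * (t - T₀)) :=
          h1.trans (mul_le_mul_of_nonneg_right (by linarith) (Real.exp_pos _).le)
        have h4 := mul_le_mul h3 h2 (h.A_nonneg t) (by positivity)
        have h5 : Real.exp ((2 * √3 + 8 * ρ) * (t - T₀)) *
            Real.exp (-((2 * √3 - 20 * ρ) * t)) ≤
            Real.exp (-((2 * √3 - 20 * ρ) * T₀) + 28 * ρ * (T₁ - T₀)) := by
          rw [← Real.exp_add]
          refine Real.exp_le_exp.2 ?_
          nlinarith [ht.2]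
        have h6 := mul_le_mul_of_nonneg_left h5 (sq_nonneg (q T₀))
        linarith
    refine hder.trans ?_
    have := mul_le_mul_of_nonneg_left hnum (sq_nonneg (q T₀))
    linarith

end Passage

end

/-! ### Transit along the heteroclinic connection and exit at the next circle. -/

section

namespace Passage

variable {A B M J u v p q : ℝ → ℝ}

/-- Over a bounded time, the second action, the mass carried by the last two modes and the product
`p q` change little if the second action is small. -/
lemma drift (h : Passage A B M J u v p q) {T₁ w a ρ k : ℝ}
    (hA : A T₁ * Real.exp (4 * w) ≤ a) (hS : 1 - ρ ≤ M T₁ + J T₁)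
    (hρ : 8 * a * w ≤ ρ) (hk : 24 * a * w ≤ k) :
    ∀ t ∈ Icc T₁ (T₁ + w), A t ≤ a ∧ 1 - 2 * ρ ≤ M t + J t ∧
      |p t * q t - p T₁ * q T₁| ≤ k := by
  have ha0 : 0 ≤ a := (mul_nonneg (h.A_nonneg T₁) (Real.exp_pos _).le).trans hA
  have hbd : ∀ t ∈ Icc T₁ (T₁ + w), A t ≤ a := by
    intro t ht
    have h1 := le_mul_exp_of_deriv_le (f := A) (a := 4) ht.1 fun r => by
      obtain ⟨d, hd, hd'⟩ := h.deriv_A r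
      refine ⟨d, hd, fun _ => (le_abs_self d).trans (hd'.trans ?_)⟩
      have h1 := h.mass r
      have h2 := h.A_nonneg r
      have h3 := h.J_nonneg r
      have : A r * (B r + M r) ≤ A r * 1 := mul_le_mul_of_nonneg_left (by linarith) h2
      linarith
    have h2 : Real.exp (4 * (t - T₁)) ≤ Real.exp (4 * w) := Real.exp_le_exp.2 (by linarith [ht.2])
    exact h1.trans ((mul_le_mul_of_nonneg_left h2 (h.A_nonneg T₁)).trans hA)
  intro t ht
  refine ⟨hbd t ht, ?_, ?_⟩
  · have h1 := le_add_of_deriv_le (f := fun t => -(M t + J t)) (a := 8 * a) ht.1 fun r =>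
      ⟨_, ((h.deriv_M r).fun_add (h.deriv_J r)).fun_neg, fun hr => by
        have h1 := hbd r ⟨hr.1.le, hr.2.le.trans ht.2⟩
        have h2 := h.left_le r
        have h3 := two_div_sqrt_three_bounds
        have h4 : A r * M r ≤ A r * 1 := mul_le_mul_of_nonneg_left
          (by linarith [h.mass r, h.A_nonneg r, h.B_nonneg r, h.J_nonneg r]) (h.A_nonneg r)
        have h5 : 2 / √3 * (u r ^ 2 - v r ^ 2) ≤ 1.2 * (u r ^ 2 + v r ^ 2) := by
          nlinarith [sq_nonneg (u r), sq_nonneg (v r)]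
        linarith⟩
    have h2 : 8 * a * (t - T₁) ≤ 8 * a * w :=
      mul_le_mul_of_nonneg_left (by linarith [ht.2]) (by positivity)
    linarith
  · have h1 := abs_sub_le_of_abs_deriv_le (f := fun t => p t * q t) (a := 24 * a) ht.1 fun r => by
      obtain ⟨d, hd, hd'⟩ := h.right.hasDerivAt_mul r
      refine ⟨d, hd, fun hr => hd'.trans ?_⟩
      have h1 := hbd r ⟨hr.1.le, hr.2.le.trans ht.2⟩
      have h2 := h.right_le r
      have h3 : M r * J r ≤ 1 * 1 := mul_le_mul
        (by linarith [h.mass r, h.A_nonneg r, h.B_nonneg r, h.J_nonneg r])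
        (by linarith [h.mass r, h.A_nonneg r, h.B_nonneg r, h.M_nonneg r])
        (h.J_nonneg r) zero_le_one
      have h4 : (p r ^ 2 + q r ^ 2) * A r ≤ 6 * a :=
        mul_le_mul (by linarith) h1 (h.A_nonneg r) (by norm_num)
      linarith
    have h2 : 24 * a * (t - T₁) ≤ 24 * a * w :=
      mul_le_mul_of_nonneg_left (by linarith [ht.2]) (by positivity)
    linarith

/-- As long as the last mode does not carry almost all the mass, it grows exponentially, and the
right bond stays close to the heteroclinic connection. -/
lemma transit_growth (h : Passage A B M J u v p q) {T₁ T ρ δ k j : ℝ} (hT : T₁ ≤ T)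
    (hρδ : ρ ≤ δ / 8)
    (hS : ∀ t ∈ Icc T₁ T, 1 - 2 * ρ ≤ M t + J t) (hK : ∀ t ∈ Icc T₁ T, |p t * q t| ≤ 2 * k)
    (hq : 0 < q T₁) (hpq : p T₁ ^ 2 ≤ q T₁ ^ 2) (hj : 0 < j) (hjJ : j ≤ J T₁)
    (hkj : 8 * k < δ / 2 * j) (hJ : ∀ t ∈ Icc T₁ T, J t ≤ 1 - δ / 2) :
    (∀ t ∈ Icc T₁ T, 2 * |p t| < q t) ∧ j * Real.exp (δ / 4 * (T - T₁)) ≤ J T := by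
  have hM : ∀ t ∈ Icc T₁ T, δ / 4 ≤ M t := fun t ht => by linarith [hS t ht, hJ t ht]
  have hflux : ∀ t, 2 * |p t| < q t → 1.2 * (M t * J t) ≤ -(2 / √3 * (p t ^ 2 - q t ^ 2)) := by
    intro t ht
    have h1 := two_div_sqrt_three_bounds.1
    have h2 := h.right_ge t
    have h3 : 4 * p t ^ 2 ≤ q t ^ 2 := by
      rw [← sq_abs (p t)]; nlinarith [abs_nonneg (p t)]
    nlinarith
  have hcone : ∀ t ∈ Icc T₁ T, 0 < q t - 2 * |p t| := by
    refine forall_lt_of_bootstrap (f := fun t => q t - 2 * |p t|)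
      (by have := h.right.continuous_left; have := h.right.continuous_right; fun_prop)
      fun t ht hlt => ?_
    have hJmono : J T₁ ≤ J t := le_of_deriv_nonneg ht.1 fun r => ⟨_, h.deriv_J r, fun hr => by
      have := hflux r (by linarith [hlt r ⟨hr.1.le, hr.2⟩])
      have := mul_nonneg (h.M_nonneg r) (h.J_nonneg r)
      linarith⟩
    have hQ : δ / 2 * j ≤ p t ^ 2 + q t ^ 2 := by
      have h1 := h.right_ge t
      have h2 : δ / 4 * j ≤ M t * J t :=
        mul_le_mul (hM t ht) (hjJ.trans hJmono) hj.le (h.M_nonneg t)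
      linarith
    have hle : |p t| ≤ q t := by
      rcases eq_or_lt_of_le ht.1 with rfl | h0
      · exact abs_le_of_sq_le_sq hpq hq.le
      · have : 0 ≤ q t - 2 * |p t| := by
          refine ge_of_tendsto (ContinuousAt.continuousWithinAt (s := Iio t)
            (f := fun t => q t - 2 * |p t|) ?_) ?_
          · have := h.right.continuous_left
            have := h.right.continuous_right
            fun_prop
          · filter_upwards [Ioo_mem_nhdsLT h0] with r hr
            exact (hlt r ⟨hr.1.le, hr.2⟩).le
        linarith [abs_nonneg (p t)]
    -- If `q ≤ 2 |p|`, then `q² ≤ 2 |p| q ≤ 4 k`, so `p² + q² ≤ 8 k`, below the lower bound that the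
    -- mass of the two modes imposes.
    by_contra! hcon
    have h1 := hK t ht
    have hq0 : 0 ≤ q t := (abs_nonneg _).trans hle
    rw [abs_mul, abs_of_nonneg hq0] at h1
    have h2 : q t ^ 2 ≤ 2 * (|p t| * q t) := by nlinarith
    have h3 : p t ^ 2 ≤ q t ^ 2 := by rw [← sq_abs (p t)]; nlinarith [abs_nonneg (p t)]
    linarith
  refine ⟨fun t ht => by linarith [hcone t ht], ?_⟩
  refine (mul_le_mul_of_nonneg_right hjJ (Real.exp_pos _).le).trans
    (mul_exp_le_of_le_deriv (f := J) hT fun t => ⟨_, h.deriv_J t, fun ht => ?_⟩)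
  have ht' : t ∈ Icc T₁ T := ⟨ht.1.le, ht.2.le⟩
  have h1 := hflux t (by linarith [hcone t ht'])
  have h2 := mul_le_mul_of_nonneg_right (hM t ht') (h.J_nonneg t)
  nlinarith [mul_nonneg (h.M_nonneg t) (h.J_nonneg t)]

/-- The mass moves to the last mode within the time `w`. -/
lemma exists_transit (h : Passage A B M J u v p q) {T₁ w ρ δ k j : ℝ} (hw : 0 ≤ w)
    (hρδ : ρ ≤ δ / 8) (hρ : 0 < ρ)
    (hS : ∀ t ∈ Icc T₁ (T₁ + w), 1 - 2 * ρ ≤ M t + J t)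
    (hK : ∀ t ∈ Icc T₁ (T₁ + w), |p t * q t| ≤ 2 * k)
    (hq : 0 < q T₁) (hpq : p T₁ ^ 2 ≤ q T₁ ^ 2) (hj : 0 < j) (hjJ : j ≤ J T₁)
    (hkj : 8 * k < δ / 2 * j) (hwj : 1 < j * Real.exp (δ / 4 * w)) (hJ1 : J T₁ < 1 - δ / 2) :
    ∃ t ∈ Ico T₁ (T₁ + w), 1 - δ < J t ∧ ∀ r ∈ Icc T₁ t, 2 * |p r| < q r := by
  have hle : T₁ ≤ T₁ + w := by linarith
  -- Otherwise the exponential growth would push `J` above 1 within the time `w`.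
  have hnot : ¬ ∀ t ∈ Icc T₁ (T₁ + w), J t ≤ 1 - δ / 2 := by
    intro hall
    have h1 := (h.transit_growth hle hρδ hS hK hq hpq hj hjJ hkj hall).2
    rw [add_sub_cancel_left] at h1
    have := hall (T₁ + w) ⟨hle, le_rfl⟩
    linarith
  push Not at hnot
  obtain ⟨t₀, ht₀, hJt₀⟩ := hnot
  let D : Set ℝ := Icc T₁ (T₁ + w) ∩ {t | 1 - δ / 2 ≤ J t}
  have hD : IsCompact D := isCompact_Icc.inter_right (isClosed_le continuous_const h.continuous_J)
  obtain ⟨t, ht, hmin⟩ := hD.exists_isLeast ⟨t₀, ht₀, hJt₀.le⟩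
  have htJ : 1 - δ / 2 ≤ J t := ht.2
  have hbefore : ∀ r ∈ Ico T₁ t, J r < 1 - δ / 2 := by
    intro r hr
    by_contra! hcon
    have := hmin ⟨⟨hr.1, hr.2.le.trans ht.1.2⟩, hcon⟩
    linarith [hr.2]
  have hlt : T₁ < t := lt_of_le_of_ne ht.1.1 (by rintro rfl; linarith)
  have hJt : J t ≤ 1 - δ / 2 := by
    refine le_of_tendsto (h.continuous_J.continuousWithinAt (s := Iio t) (x := t)) ?_
    filter_upwards [Ioo_mem_nhdsLT hlt] with r hr
    exact (hbefore r ⟨hr.1.le, hr.2⟩).le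
  have hall : ∀ r ∈ Icc T₁ t, J r ≤ 1 - δ / 2 := by
    intro r hr
    rcases eq_or_lt_of_le hr.2 with rfl | h0
    · exact hJt
    · exact (hbefore r ⟨hr.1, h0⟩).le
  have hsub : ∀ r ∈ Icc T₁ t, r ∈ Icc T₁ (T₁ + w) := fun r hr => ⟨hr.1, hr.2.trans ht.1.2⟩
  have hgrow := h.transit_growth ht.1.1 hρδ (fun r hr => hS r (hsub r hr))
    (fun r hr => hK r (hsub r hr)) hq hpq hj hjJ hkj hall
  refine ⟨t, ⟨ht.1.1, lt_of_le_of_ne ht.1.2 ?_⟩, by linarith, hgrow.1⟩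
  rintro rfl
  have h2 := hgrow.2
  rw [add_sub_cancel_left] at h2
  linarith

/-- Control near the next circle, as long as the last mode dominates. -/
lemma near_next_circle (h : Passage A B M J u v p q) {t₂ τ δ a k T : ℝ} (hT : t₂ ≤ T)
    (hTτ : T ≤ t₂ + 2 * τ) (hδ : 0 ≤ δ) (ha : A t₂ ≤ a) (hk : 0 < k)
    (hK : 2 * k ≤ p t₂ * q t₂) (hq : 0 < q t₂)
    (hnum : 48 * τ * (a * Real.exp (8 * δ * τ)) ≤ k)
    (hJ : ∀ t ∈ Ico t₂ T, 1 - δ < J t) :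
    ∀ t ∈ Icc t₂ T, k ≤ p t * q t ∧ 0 < q t ∧ 0 < p t := by
  have ha0 : 0 ≤ a := (h.A_nonneg t₂).trans ha
  have hτ : 0 ≤ τ := by linarith
  have hA : ∀ t ∈ Icc t₂ T, A t ≤ a * Real.exp (8 * δ * τ) := by
    intro t ht
    have h1 := le_mul_exp_of_deriv_le (f := A) (a := 4 * δ) ht.1 fun r => by
      obtain ⟨d, hd, hd'⟩ := h.deriv_A r
      refine ⟨d, hd, fun hr => (le_abs_self d).trans (hd'.trans ?_)⟩
      have h1 := h.mass r
      have h2 := h.A_nonneg r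
      have h3 := hJ r ⟨hr.1.le, hr.2.trans_le ht.2⟩
      have : A r * (B r + M r) ≤ A r * δ := mul_le_mul_of_nonneg_left (by linarith) h2
      linarith
    have h2 : Real.exp (4 * δ * (t - t₂)) ≤ Real.exp (8 * δ * τ) := by
      refine Real.exp_le_exp.2 ?_
      have : δ * (t - t₂) ≤ δ * (2 * τ) := mul_le_mul_of_nonneg_left (by linarith [ht.2]) hδ
      linarith
    exact h1.trans (mul_le_mul ha h2 (Real.exp_pos _).le ha0)
  have hKt : ∀ t ∈ Icc t₂ T, k ≤ p t * q t := by
    intro t ht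
    have h1 := abs_sub_le_of_abs_deriv_le (f := fun t => p t * q t)
      (a := 24 * (a * Real.exp (8 * δ * τ))) ht.1 fun r => by
        obtain ⟨d, hd, hd'⟩ := h.right.hasDerivAt_mul r
        refine ⟨d, hd, fun hr => hd'.trans ?_⟩
        have h1 := hA r ⟨hr.1.le, hr.2.le.trans ht.2⟩
        have h2 := h.right_le r
        have h3 : M r * J r ≤ 1 * 1 := mul_le_mul
          (by linarith [h.mass r, h.A_nonneg r, h.B_nonneg r, h.J_nonneg r])
          (by linarith [h.mass r, h.A_nonneg r, h.B_nonneg r, h.M_nonneg r])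
          (h.J_nonneg r) zero_le_one
        have h4 : (p r ^ 2 + q r ^ 2) * A r ≤ 6 * (a * Real.exp (8 * δ * τ)) :=
          mul_le_mul (by linarith) h1 (h.A_nonneg r) (by norm_num)
        linarith
    have h2 : 24 * (a * Real.exp (8 * δ * τ)) * (t - t₂) ≤
        24 * (a * Real.exp (8 * δ * τ)) * (2 * τ) :=
      mul_le_mul_of_nonneg_left (by linarith [ht.2]) (by positivity)
    have h3 := (abs_le.1 h1).1
    linarith
  have hqpos := forall_pos_of_ne_zero h.right.continuous_right hq (T := T) fun t ht h0 => by
    have := hKt t ht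
    rw [h0, mul_zero] at this
    linarith
  intro t ht
  refine ⟨hKt t ht, hqpos t ht, ?_⟩
  exact pos_of_mul_pos_left (hk.trans_le (hKt t ht)) (hqpos t ht).le

/-- If `p q > 0`, the orbit enters the expanding cone of the right bond near the next circle. -/
lemma exists_exit (h : Passage A B M J u v p q) {t₂ τ δ a k : ℝ} (hτ : 0 ≤ τ) (hδ : 0 ≤ δ)
    (hδ1 : δ ≤ 1 / 100) (ha : A t₂ ≤ a) (hk : 0 < k) (hK : 2 * k ≤ p t₂ * q t₂)
    (hq : 0 < q t₂) (hJ : 1 - δ < J t₂)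
    (hnum : 48 * τ * (a * Real.exp (8 * δ * τ)) ≤ k)
    (hnum2 : 6 * Real.exp (-(6 * τ)) < k) :
    ∃ t₃, t₂ ≤ t₃ ∧ (∀ t ∈ Icc t₂ t₃, 1 - δ < J t) ∧ |q t₃| < p t₃ := by
  -- As long as `0 < p ≤ q`, the flux is directed into the last mode, so `J` does not decrease.
  have hstay : ∀ T, T ≤ t₂ + 2 * τ → (∀ t ∈ Ico t₂ T, p t ≤ q t) →
      ∀ t ∈ Icc t₂ T, 1 - δ < J t := by
    intro T hT hpq
    refine forall_lt_of_bootstrap h.continuous_J fun t ht hlt => ?_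
    have hctl := h.near_next_circle ht.1 (ht.2.trans hT) hδ ha hk hK hq hnum hlt
    refine hJ.trans_le (le_of_deriv_nonneg ht.1 fun r => ⟨_, h.deriv_J r, fun hr => ?_⟩)
    obtain ⟨-, h2, h3⟩ := hctl r ⟨hr.1.le, hr.2.le⟩
    have h4 := hpq r ⟨hr.1.le, hr.2.trans_le ht.2⟩
    have h5 := two_div_sqrt_three_bounds.1
    have h6 : p r ^ 2 ≤ q r ^ 2 := pow_le_pow_left₀ h3.le h4 2
    nlinarith
  let D : Set ℝ := {t | t ∈ Icc t₂ (t₂ + 2 * τ) ∧ q t < p t}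
  -- If `p ≤ q` throughout, `q²` decays at rate 3 over the time `2 τ` and ends below `k`,
  -- contradicting `k ≤ p q ≤ q²`.
  have hD : D.Nonempty := by
    by_contra hempty
    have hpq : ∀ t ∈ Icc t₂ (t₂ + 2 * τ), p t ≤ q t := by
      intro t ht
      by_contra! hcon
      exact hempty ⟨t, ht, hcon⟩
    have hJt := hstay (t₂ + 2 * τ) le_rfl fun t ht => hpq t ⟨ht.1, ht.2.le⟩
    have hctl := h.near_next_circle (T := t₂ + 2 * τ) (by linarith) le_rfl hδ ha hk hK hq hnum
      fun t ht => hJt t ⟨ht.1, ht.2.le⟩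
    have hdec := le_mul_exp_of_deriv_le (f := fun t => q t ^ 2) (a := -3)
      (show t₂ ≤ t₂ + 2 * τ by linarith) fun r => by
        obtain ⟨d, hd, hd'⟩ := h.right.swap.hasDerivAt_sq r
        refine ⟨d, hd, fun hr => ?_⟩
        have hr' : r ∈ Icc t₂ (t₂ + 2 * τ) := ⟨hr.1.le, hr.2.le⟩
        obtain ⟨-, h2, h3⟩ := hctl r hr'
        have h6 : p r ^ 2 ≤ q r ^ 2 := pow_le_pow_left₀ h3.le (hpq r hr') 2
        refine (hd' (by nlinarith [sq_nonneg (q r)])).2.trans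
          (mul_le_mul_of_nonneg_right ?_ (sq_nonneg _))
        have := hJt r hr'
        have := h.mass r
        have := h.A_nonneg r
        have := h.B_nonneg r
        have := h.M_nonneg r
        have := sqrt_three_bounds.1
        nlinarith
    have hend : t₂ + 2 * τ ∈ Icc t₂ (t₂ + 2 * τ) := ⟨by linarith, le_rfl⟩
    obtain ⟨h1, h2, h3⟩ := hctl _ hend
    have h4 := mul_le_mul_of_nonneg_right (hpq _ hend) h2.le
    have h5 : q t₂ ^ 2 ≤ 6 := by
      have h1 := h.right_le t₂
      have h3 : M t₂ * J t₂ ≤ 1 * 1 := mul_le_mul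
        (by linarith [h.mass t₂, h.A_nonneg t₂, h.B_nonneg t₂, h.J_nonneg t₂])
        (by linarith [h.mass t₂, h.A_nonneg t₂, h.B_nonneg t₂, h.M_nonneg t₂])
        (h.J_nonneg t₂) zero_le_one
      nlinarith [sq_nonneg (p t₂)]
    have h6 : -3 * (t₂ + 2 * τ - t₂) = -(6 * τ) := by ring
    rw [h6] at hdec
    have h7 := mul_le_mul_of_nonneg_right h5 (Real.exp_pos (-(6 * τ))).le
    nlinarith
  have hbdd : BddBelow D := ⟨t₂, fun t ht => ht.1.1⟩
  have hb1 : t₂ ≤ sInf D := le_csInf hD fun t ht => ht.1.1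
  obtain ⟨t₀, ht₀⟩ := hD
  have hb2 : sInf D ≤ t₂ + 2 * τ := (csInf_le hbdd ht₀).trans ht₀.1.2
  have hJb := hstay (sInf D) hb2 fun t ht => by
    by_contra! hcon
    have := csInf_le hbdd (show t ∈ D from ⟨⟨ht.1, ht.2.le.trans hb2⟩, hcon⟩)
    linarith [ht.2]
  have hev : ∀ᶠ t in 𝓝 (sInf D), 1 - δ < J t :=
    h.continuous_J.continuousAt.eventually (lt_mem_nhds (hJb _ ⟨hb1, le_rfl⟩))
  obtain ⟨e, he, hball⟩ := Metric.eventually_nhds_iff.1 hev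
  -- The infimum need not give a strict inequality; a point of `D` just after it does, and `J` is
  -- still above `1 - δ` there.
  obtain ⟨t₃, ht₃, hlt⟩ := exists_lt_of_csInf_lt ⟨t₀, ht₀⟩ (show sInf D < sInf D + e by linarith)
  have hge : sInf D ≤ t₃ := csInf_le hbdd ht₃
  have hJ3 : ∀ t ∈ Icc t₂ t₃, 1 - δ < J t := by
    intro t ht
    rcases le_total t (sInf D) with h0 | h0
    · exact hJb t ⟨ht.1, h0⟩
    · refine hball ?_
      rw [Real.dist_eq, abs_of_nonneg (by linarith)]
      linarith [ht.2]
  refine ⟨t₃, ht₃.1.1, hJ3, ?_⟩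
  obtain ⟨-, h2, -⟩ := h.near_next_circle ht₃.1.1 ht₃.1.2 hδ ha hk hK hq hnum
    (fun t ht => hJ3 t ⟨ht.1, ht.2.le⟩) t₃ ⟨ht₃.1.1, le_rfl⟩
  rw [abs_of_pos h2]
  exact ht₃.2

end Passage

end

section

/-! ### Choice of the parameters -/

lemma tendsto_mul_exp_neg : Tendsto (fun T : ℝ => T * Real.exp (-T)) atTop (𝓝 0) := by
  simpa using Real.tendsto_pow_mul_exp_neg_atTop_nhds_zero 1

/-- One large time `T` drives everything: with `κ = K + 8`, take `T₀ = T`, `τ = κ T`, `w = T / 8`.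
The size `η = √(ρ/8) E`, with `E` about `exp (-√3 τ)`, lets the inserted mass grow to order `ρ` by
`T₀ + τ`, at most. The bound `a = 2 E² exp (-2T)` on the second action is far below `η²`, thanks to
the extra decay during `[0, T₀]`. Since `κ > K`, the insertion stays small after flowing back by
`T₀`. Since `ρ κ` is tiny against `δ`, the loss `exp (28 ρ τ)` in `j` is beaten by `exp (δ w / 4)`;
since `δ κ ≤ 1/100`, the factor `exp (8 δ τ)` costs little against `exp (-2T)`. -/
lemma exists_parameters {K δ ρ R : ℝ} (hK : 0 ≤ K) (hρ : 0 < ρ) (hρδ : ρ * (8000 * (K + 8)) = δ)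
    (hδ : δ * (100 * (K + 8)) ≤ 1) (hR : 0 < R) :
    ∃ T₀ τ w η a j : ℝ, 0 ≤ T₀ ∧ 0 ≤ τ ∧ 0 ≤ w ∧ 0 < η ∧ η ≤ 1 / 10 ∧
      η ^ 2 * Real.exp (8 * T₀) ≤ ρ / 4 ∧
      2 * η ^ 2 * Real.exp ((2 * √3 + 8 * ρ) * τ) ≤ ρ / 4 ∧
      16 * τ * Real.exp (-((2 * √3 - 20 * ρ) * T₀) + 28 * ρ * τ) ≤ 1 / 4 ∧
      2 * Real.exp (-((2 * √3 - 20 * ρ) * (T₀ + τ))) * Real.exp (4 * w) ≤ a ∧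
      8 * a * w ≤ ρ ∧ 24 * a * w ≤ η ^ 2 / 16 ∧
      48 * τ * (a * Real.exp (8 * δ * τ)) ≤ η ^ 2 / 16 ∧
      6 * Real.exp (-(6 * τ)) < η ^ 2 / 16 ∧
      0 < j ∧ j ≤ η ^ 2 / 24 * Real.exp ((2 * √3 - 20 * ρ) * τ) ∧
      8 * η ^ 2 < δ / 2 * j ∧ 1 < j * Real.exp (δ / 4 * w) ∧
      2 * η * Real.exp (K * T₀) < R := by
  obtain ⟨hs1, hs2⟩ := sqrt_three_bounds
  set κ := K + 8 with hκ
  have hκ8 : 8 ≤ κ := by linarith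
  have hδ0 : 0 < δ := by rw [← hρδ]; positivity
  have hδ1 : δ ≤ 1 / 800 := by nlinarith
  have hρ1 : ρ ≤ 1 / 10000 := by nlinarith
  have hκρ : ρ * κ = δ / 8000 := by linarith
  have hκδ : δ * κ ≤ 1 / 100 := by linarith
  have hsmall : ∀ c : ℝ, 0 < c → ∀ᶠ T : ℝ in atTop, T * Real.exp (-T) ≤ c := fun c hc =>
    (tendsto_mul_exp_neg.eventually (gt_mem_nhds hc)).mono fun _ h => h.le
  have hexp : ∀ c : ℝ, 0 < c → ∀ᶠ T : ℝ in atTop, Real.exp (-T) < c := fun c hc =>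
    Real.tendsto_exp_neg_atTop_nhds_zero.eventually (gt_mem_nhds hc)
  have hbig : ∀ᶠ T : ℝ in atTop, 192 / ρ < Real.exp (δ / 64 * T) :=
    (Real.tendsto_exp_atTop.comp (tendsto_id.const_mul_atTop (by positivity :
      0 < δ / 64))).eventually (eventually_gt_atTop _)
  obtain ⟨T, hT0, h1, h2, h3, h4, h5, h6⟩ := ((eventually_ge_atTop (0 : ℝ)).and
    ((hsmall (1 / (64 * κ)) (by positivity)).and
    ((hsmall (ρ / (48 * 256 * κ)) (by positivity)).and
    ((hexp (ρ / 768) (by positivity)).and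
    ((hexp (δ / 384) (by positivity)).and (hbig.and (hexp (R / 2) (by positivity)))))))).exists
  have hκT : 0 ≤ κ * T := by positivity
  have h8T : 8 * T ≤ κ * T := mul_le_mul_of_nonneg_right hκ8 hT0
  have hρκT : ρ * (κ * T) = δ / 8000 * T := by rw [← mul_assoc, hκρ]
  have hδκT : δ * (κ * T) ≤ 1 / 100 * T := by
    rw [← mul_assoc]; exact mul_le_mul_of_nonneg_right hκδ hT0
  have hδT : δ * T ≤ 1 / 800 * T := mul_le_mul_of_nonneg_right hδ1 hT0
  have hρT : ρ * T ≤ 1 / 10000 * T := mul_le_mul_of_nonneg_right hρ1 hT0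
  have hρT0 : 0 ≤ ρ * T := by positivity
  have hs1T : 1.73 * T ≤ √3 * T := mul_le_mul_of_nonneg_right hs1.le hT0
  have hs1κ : 1.73 * (κ * T) ≤ √3 * (κ * T) := mul_le_mul_of_nonneg_right hs1.le hκT
  have hs2κ : √3 * (κ * T) ≤ 1.74 * (κ * T) := mul_le_mul_of_nonneg_right hs2.le hκT
  have hρκT0 : 0 ≤ ρ * (κ * T) := by positivity
  obtain ⟨E, hE⟩ : ∃ E, E = Real.exp (-((√3 + 4 * ρ) * (κ * T))) := ⟨_, rfl⟩
  have hE0 : 0 < E := hE ▸ Real.exp_pos _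
  have hE2 : E ^ 2 = Real.exp (-((2 * √3 + 8 * ρ) * (κ * T))) := by
    rw [hE, ← Real.exp_nat_mul]; congr 1; push_cast; ring
  have hη2 : (√(ρ / 8) * E) ^ 2 = ρ / 8 * E ^ 2 := by
    rw [mul_pow, Real.sq_sqrt (by positivity)]
  have hEle : E ≤ 1 := hE ▸ Real.exp_le_one_iff.2 (by linarith)
  have hρ8 : √(ρ / 8) ≤ 1 / 10 := by
    rw [Real.sqrt_le_left (by norm_num)]; linarith
  have hE20 : 0 < E ^ 2 := by positivity
  have hE21 : E ^ 2 ≤ 1 := pow_le_one₀ hE0.le hEle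
  have hT2 : T * Real.exp (-2 * T) ≤ ρ / (48 * 256 * κ) := by
    refine le_trans (mul_le_mul_of_nonneg_left (Real.exp_le_exp.2 (by linarith)) hT0) h2
  have hκ0 : ρ / (48 * 256 * κ) ≤ ρ / (48 * 256 * 8) :=
    div_le_div_of_nonneg_left hρ.le (by norm_num) (by linarith)
  refine ⟨T, κ * T, T / 8, √(ρ / 8) * E, 2 * E ^ 2 * Real.exp (-2 * T),
    ρ / 192 * Real.exp (-(28 * ρ * (κ * T))), hT0, hκT, by positivity, by positivity, ?_, ?_, ?_,
    ?_, ?_, ?_, ?_, ?_, ?_, by positivity, ?_, ?_, ?_, ?_⟩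
  · exact (mul_le_mul hρ8 hEle hE0.le (by norm_num)).trans (by norm_num)
  · rw [hη2, hE2, mul_assoc, ← Real.exp_add]
    have : Real.exp (-((2 * √3 + 8 * ρ) * (κ * T)) + 8 * T) ≤ 1 :=
      Real.exp_le_one_iff.2 (by linarith)
    have := mul_le_mul_of_nonneg_left this hρ.le
    linarith
  · rw [hη2, hE2, mul_assoc, mul_assoc, ← Real.exp_add, neg_add_cancel, Real.exp_zero]
    linarith
  · have e1 : Real.exp (-((2 * √3 - 20 * ρ) * T) + 28 * ρ * (κ * T)) ≤ Real.exp (-T) :=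
      Real.exp_le_exp.2 (by linarith)
    have e2 := mul_le_mul_of_nonneg_left e1 hT0
    have e3 := mul_le_mul_of_nonneg_left (e2.trans h1) (by positivity : 0 ≤ 16 * κ)
    have e4 : 16 * κ * (1 / (64 * κ)) = 1 / 4 := by field_simp; norm_num
    linarith
  · rw [hE2, mul_assoc, mul_assoc, ← Real.exp_add, ← Real.exp_add]
    refine mul_le_mul_of_nonneg_left (Real.exp_le_exp.2 ?_) (by norm_num)
    linarith
  · have := mul_le_mul_of_nonneg_left (hT2.trans hκ0) hE20.le
    have := mul_le_mul_of_nonneg_right hE21 hρ.le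
    linarith
  · rw [hη2]
    have := mul_le_mul_of_nonneg_left (hT2.trans hκ0) hE20.le
    have := mul_pos hE20 hρ
    linarith
  · rw [hη2]
    have e1 : Real.exp (-2 * T) * Real.exp (8 * δ * (κ * T)) ≤ Real.exp (-T) := by
      rw [← Real.exp_add]; exact Real.exp_le_exp.2 (by linarith)
    have e2 := mul_le_mul_of_nonneg_left e1 hT0
    have e3 := mul_le_mul_of_nonneg_left (e2.trans h2) (by positivity : 0 ≤ 96 * κ * E ^ 2)
    have e4 : 96 * κ * E ^ 2 * (ρ / (48 * 256 * κ)) = ρ / 8 * E ^ 2 / 16 := by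
      field_simp; norm_num
    linarith
  · rw [hη2, hE2]
    have e1 : Real.exp (-(6 * (κ * T))) ≤
        Real.exp (-((2 * √3 + 8 * ρ) * (κ * T))) * Real.exp (-T) := by
      rw [← Real.exp_add]; exact Real.exp_le_exp.2 (by linarith)
    have e2 := mul_lt_mul_of_pos_left h3 (Real.exp_pos (-((2 * √3 + 8 * ρ) * (κ * T))))
    linarith
  · rw [hη2, hE2]
    have e1 : Real.exp (-(28 * ρ * (κ * T))) = Real.exp (-((2 * √3 + 8 * ρ) * (κ * T))) *
        Real.exp ((2 * √3 - 20 * ρ) * (κ * T)) := by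
      rw [← Real.exp_add]; congr 1; ring
    rw [e1]
    linarith
  · rw [hη2, hE2]
    have e1 : Real.exp (-((2 * √3 + 8 * ρ) * (κ * T))) ≤
        Real.exp (-(28 * ρ * (κ * T))) * Real.exp (-T) := by
      rw [← Real.exp_add]; exact Real.exp_le_exp.2 (by linarith)
    have e2 := mul_lt_mul_of_pos_left h4 (Real.exp_pos (-(28 * ρ * (κ * T))))
    have e3 := mul_lt_mul_of_pos_left (e1.trans_lt e2) hρ
    linarith
  · have e1 : Real.exp (δ / 64 * T) ≤
        Real.exp (-(28 * ρ * (κ * T))) * Real.exp (δ / 4 * (T / 8)) := by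
      rw [← Real.exp_add]
      refine Real.exp_le_exp.2 ?_
      have : 0 ≤ δ * T := by positivity
      linarith
    have e2 := mul_lt_mul_of_pos_left (h5.trans_le e1) (by positivity : 0 < ρ / 192)
    have e3 : ρ / 192 * (192 / ρ) = 1 := by field_simp
    linarith
  · have e1 : E * Real.exp (K * T) ≤ Real.exp (-T) := by
      rw [hE, ← Real.exp_add]
      refine Real.exp_le_exp.2 ?_
      have : K * T = κ * T - 8 * T := by rw [hκ]; ring
      linarith
    have e2 : √(ρ / 8) * (E * Real.exp (K * T)) ≤ 1 * Real.exp (-T) :=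
      mul_le_mul (hρ8.trans (by norm_num)) e1 (by positivity) zero_le_one
    linarith

end

section

variable {N : ℕ}

/-! ### The flow on the unit sphere -/

/-- A global flow that solves the toy model system on the unit sphere. -/
structure SphereFlow (K : ℝ) (Φ : ℝ → Phase N → Phase N) : Prop where
  zero : ∀ x, Φ 0 x = x
  add : ∀ s t x, Φ s (Φ t x) = Φ (s + t) x
  dist_le : ∀ t x y, dist (Φ t x) (Φ t y) ≤ dist x y * Real.exp (K * |t|)
  continuous : Continuous fun z : ℝ × Phase N => Φ z.1 z.2
  norm : ∀ t x, ‖x‖ = 1 → ‖Φ t x‖ = 1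
  hasDerivAt : ∀ x, ‖x‖ = 1 → ∀ t, HasDerivAt (fun s => Φ s x) (vectorField (Φ t x)) t

theorem exists_sphereFlow (N : ℕ) :
    ∃ (K : ℝ) (Φ : ℝ → Phase N → Phase N), 0 ≤ K ∧ SphereFlow K Φ := by
  obtain ⟨K, Φ, f, hK, hΦ, hn, hf⟩ := exists_flow N
  refine ⟨K, Φ, hK, hΦ.zero, hΦ.add, hΦ.dist_le, hΦ.continuous, hn, fun x hx t => ?_⟩
  rw [← hf _ (hn t x hx)]
  exact hΦ.hasDerivAt x t

namespace SphereFlow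

variable {K : ℝ} {Φ : ℝ → Phase N → Phase N}

lemma continuous_time (h : SphereFlow K Φ) (x : Phase N) : Continuous fun t => Φ t x :=
  h.continuous.comp (by fun_prop : Continuous fun t : ℝ => (t, x))

lemma continuous_space (h : SphereFlow K Φ) (t : ℝ) : Continuous (Φ t) :=
  h.continuous.comp (by fun_prop : Continuous fun x : Phase N => (t, x))

lemma abs_deriv_act_le (h : SphereFlow K Φ) {x : Phase N} (hx : ‖x‖ = 1) (k : ℕ) (t : ℝ) :
    ∃ d, HasDerivAt (fun s => act (k + 1) (Φ s x)) d t ∧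
      |d| ≤ 4 * act (k + 1) (Φ t x) * (act k (Φ t x) + act (k + 2) (Φ t x)) := by
  refine ⟨_, hasDerivAt_act (h.hasDerivAt x hx t) k, ?_⟩
  have h1 := abs_flux_le k (Φ t x)
  have h2 := abs_flux_le (k + 1) (Φ t x)
  refine (abs_sub _ _).trans ?_
  linarith

/-- Each action has derivative at most 4 times itself in modulus, so an empty mode stays empty in
both time directions. Supports are therefore invariant under the flow. -/
lemma act_eq_zero (h : SphereFlow K Φ) {x : Phase N} (hx : ‖x‖ = 1) {k : ℕ}
    (hk : act k x = 0) (t : ℝ) : act k (Φ t x) = 0 := by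
  obtain _ | k := k
  · simp [act, mode_zero]
  have hd : ∀ r, ∃ d, HasDerivAt (fun s => act (k + 1) (Φ s x)) d r ∧
      |d| ≤ 4 * act (k + 1) (Φ r x) := by
    intro r
    obtain ⟨d, hd, hd'⟩ := h.abs_deriv_act_le hx k r
    refine ⟨d, hd, hd'.trans (mul_le_of_le_one_right
      (mul_nonneg (by norm_num) (act_nonneg _ _)) ?_)⟩
    have := sum_four_act_le (Φ r x) k
    rw [h.norm r x hx] at this
    linarith [act_nonneg (k + 1) (Φ r x), act_nonneg (k + 3) (Φ r x)]
  refine le_antisymm ?_ (act_nonneg _ _)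
  rcases le_total 0 t with ht | ht
  · have := le_mul_exp_of_deriv_le (f := fun s => act (k + 1) (Φ s x)) (a := 4) ht fun r => by
      obtain ⟨d, hd, hd'⟩ := hd r
      exact ⟨d, hd, fun _ => (abs_le.1 hd').2⟩
    simpa [h.zero, hk] using this
  · have := mul_exp_le_of_le_deriv (f := fun s => act (k + 1) (Φ s x)) (a := -4) ht fun r => by
      obtain ⟨d, hd, hd'⟩ := hd r
      exact ⟨d, hd, fun _ => by linarith [(abs_le.1 hd').1]⟩
    rw [h.zero, hk] at this
    exact nonpos_of_mul_nonpos_left this (Real.exp_pos _)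

lemma act_pos (h : SphereFlow K Φ) {x : Phase N} (hx : ‖x‖ = 1) {k : ℕ}
    (hk : 0 < act k x) (t : ℝ) : 0 < act k (Φ t x) := by
  refine lt_of_le_of_ne (act_nonneg _ _) fun h0 => hk.ne' ?_
  have := h.act_eq_zero (h.norm t x hx) h0.symm (-t)
  rwa [h.add, neg_add_cancel, h.zero] at this

/-- An orbit supported on the modes up to `k + 3` gives rise to a passage. -/
lemma passage (h : SphereFlow K Φ) {x : Phase N} (hx : ‖x‖ = 1) {k : ℕ}
    (hs : ∀ j, k + 3 < j → act j x = 0) :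
    Passage (fun t => act (k + 1) (Φ t x)) (fun t => act k (Φ t x))
      (fun t => act (k + 2) (Φ t x)) (fun t => act (k + 3) (Φ t x))
      (fun t => bondU (k + 1) (Φ t x)) (fun t => bondV (k + 1) (Φ t x))
      (fun t => bondU (k + 2) (Φ t x)) (fun t => bondV (k + 2) (Φ t x)) where
  A_nonneg t := act_nonneg _ _
  B_nonneg t := act_nonneg _ _
  M_nonneg t := act_nonneg _ _
  J_nonneg t := act_nonneg _ _
  mass t := by
    have := sum_four_act_le (Φ t x) k
    rw [h.norm t x hx] at this
    linarith
  deriv_A t := h.abs_deriv_act_le hx k t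
  deriv_M t := hasDerivAt_act (h.hasDerivAt x hx t) (k + 1)
  deriv_J t := by
    refine (hasDerivAt_act (h.hasDerivAt x hx t) (k + 2)).congr_deriv ?_
    have h0 := h.act_eq_zero hx (hs (k + 4) (by omega)) t
    rw [bondU_eq_zero (k := k + 2 + 1) h0, bondV_eq_zero (k := k + 2 + 1) h0]
    ring
  left := ⟨fun t => add_nonneg (act_nonneg _ _) (act_nonneg _ _), fun t =>
    hasDerivAt_bondUV (h.hasDerivAt x hx t) k⟩
  right := ⟨fun t => act_nonneg _ _, fun t => by
    have := hasDerivAt_bondUV (h.hasDerivAt x hx t) (k + 1)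
    rwa [h.act_eq_zero hx (hs (k + 1 + 3) (by omega)) t, add_zero] at this⟩
  left_ge t := two_mul_act_le _ _
  left_le t := bond_sq_le _ _
  right_ge t := two_mul_act_le _ _
  right_le t := bond_sq_le _ _

end SphereFlow

lemma mode_norm_le_supNorm (x : Phase N) (k : ℕ) : ‖mode x k‖ ≤ supNorm x := by
  unfold mode supNorm
  split_ifs with h
  · exact norm_le_pi_norm (WithLp.ofLp x) _
  · simp

lemma half_lt_supNorm {x : Phase N} {k : ℕ} (h : 1 / 4 < act k x) : 1 / 2 < supNorm x := by
  have h1 := mode_norm_le_supNorm x k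
  rw [act] at h
  nlinarith [norm_nonneg (mode x k)]

lemma continuous_supNorm : Continuous (supNorm : Phase N → ℝ) :=
  (PiLp.continuous_ofLp 2 _).norm

/-- The points that can be reached from the vicinity of the third circle without ever spreading
the mass too thinly. -/
def Reach (Φ : ℝ → Phase N → Phase N) (ε : ℝ) : Set (Phase N) :=
  {y | ∃ T, 0 ≤ T ∧ 1 - ε < act 3 (Φ (-T) y) ∧ ∀ t ∈ Icc 0 T, 1 / 2 < supNorm (Φ (-t) y)}

/-- Tube lemma over the compact time interval. -/
lemma eventually_forall_flow_mem {X : Type*} [TopologicalSpace X] {g : ℝ → X → Phase N}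
    (hg : Continuous fun z : ℝ × X => g z.1 z.2) {U : Set (Phase N)} (hU : IsOpen U)
    {a b : ℝ} {x : X} (hx : ∀ t ∈ Icc a b, g t x ∈ U) :
    ∀ᶠ y in 𝓝 x, ∀ t ∈ Icc a b, g t y ∈ U := by
  refine isCompact_Icc.eventually_forall_of_forall_eventually
    (P := fun y t => g t y ∈ U) fun t ht => ?_
  have : Continuous fun z : X × ℝ => g z.2 z.1 := hg.comp continuous_swap
  exact this.continuousAt.eventually (hU.mem_nhds (hx t ht))

/-- Openness is what permits the insertion of a small mass in the next mode without losing
reachability. -/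
lemma isOpen_reach {K : ℝ} {Φ : ℝ → Phase N → Phase N} (h : SphereFlow K Φ) (ε : ℝ) :
    IsOpen (Reach Φ ε) := by
  rw [isOpen_iff_mem_nhds]
  rintro y ⟨T, hT, h1, h2⟩
  have e1 : ∀ᶠ z in 𝓝 y, 1 - ε < act 3 (Φ (-T) z) :=
    ((continuous_act 3).comp (h.continuous_space (-T))).continuousAt.eventually (lt_mem_nhds h1)
  have hc : Continuous fun z : ℝ × Phase N => Φ (-z.1) z.2 :=
    h.continuous.comp (by fun_prop : Continuous fun z : ℝ × Phase N => (-z.1, z.2))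
  have e2 := eventually_forall_flow_mem (g := fun t y => Φ (-t) y) hc
    (isOpen_lt continuous_const continuous_supNorm : IsOpen {x : Phase N | 1 / 2 < supNorm x}) h2
  filter_upwards [e1, e2] with z hz1 hz2
  exact ⟨T, hT, hz1, hz2⟩

lemma Reach.flow {K : ℝ} {Φ : ℝ → Phase N → Phase N} (h : SphereFlow K Φ) {ε : ℝ} {y : Phase N}
    (hy : y ∈ Reach Φ ε) {t : ℝ} (ht : 0 ≤ t) (hs : ∀ r ∈ Icc 0 t, 1 / 2 < supNorm (Φ r y)) :
    Φ t y ∈ Reach Φ ε := by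
  obtain ⟨T, hT, h1, h2⟩ := hy
  refine ⟨T + t, by linarith, ?_, fun r hr => ?_⟩
  · rw [h.add, show -(T + t) + t = -T by ring]
    exact h1
  · rw [h.add]
    rcases le_total r t with hrt | hrt
    · exact hs _ ⟨by linarith, by linarith [hr.1]⟩
    · have := h2 (r - t) ⟨by linarith, by linarith [hr.2]⟩
      rwa [show -(r - t) = -r + t by ring] at this

/-! ### Inserting mass in the next mode -/

/-- The unit vector of the mode `j`. -/
noncomputable def unitVec (N j : ℕ) : Phase N :=
  WithLp.toLp 2 fun i : Fin N => if (i : ℕ) + 1 = j then 1 else 0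

lemma mode_unitVec {j : ℕ} (h1 : 1 ≤ j) (h2 : j ≤ N) (k : ℕ) :
    mode (unitVec N j) k = if k = j then 1 else 0 := by
  by_cases h : 1 ≤ k ∧ k ≤ N
  · simp [mode, h, unitVec]
  · rw [if_neg (by omega)]
    simp only [mode, h, dif_neg, not_false_eq_true]

lemma mode_add (x y : Phase N) (k : ℕ) : mode (x + y) k = mode x k + mode y k := by
  by_cases h : 1 ≤ k ∧ k ≤ N <;> simp [mode, h]

lemma mode_csmul (z : ℂ) (x : Phase N) (k : ℕ) : mode (z • x) k = z * mode x k := by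
  by_cases h : 1 ≤ k ∧ k ≤ N <;> simp [mode, h]

lemma norm_unitVec {j : ℕ} (h1 : 1 ≤ j) (h2 : j ≤ N) : ‖unitVec N j‖ = 1 := by
  have : ‖unitVec N j‖ ^ 2 = 1 := by
    rw [norm_sq_eq_sum_act_of_lt _ (Nat.lt_succ_self N),
      Finset.sum_eq_single_of_mem j (Finset.mem_range.2 (by omega))]
    · simp [act, mode_unitVec h1 h2]
    · intro b _ hb
      simp [act, mode_unitVec h1 h2, hb]
  nlinarith [norm_nonneg (unitVec N j)]

/-- Multiply the mode `m` by `c` and put `d` times the mode `m` in the mode `m + 1`. -/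
noncomputable def insertMode (m : ℕ) (c : ℝ) (d : ℂ) (x : Phase N) : Phase N :=
  x + (((c : ℂ) - 1) * mode x m) • unitVec N m + (d * mode x m) • unitVec N (m + 1)

lemma mode_insertMode {m : ℕ} (h1 : 1 ≤ m) (h2 : m + 1 ≤ N) {c : ℝ} {d : ℂ} {x : Phase N}
    (hx : mode x (m + 1) = 0) (j : ℕ) :
    mode (insertMode m c d x) j =
      if j = m then c * mode x m else if j = m + 1 then d * mode x m else mode x j := by
  rw [insertMode, mode_add, mode_add, mode_csmul, mode_csmul, mode_unitVec h1 (by omega),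
    mode_unitVec (by omega) h2]
  by_cases hj : j = m
  · subst hj; simp; ring
  · by_cases hj' : j = m + 1
    · subst hj'; simp [hx]
    · simp [hj, hj']

lemma norm_insertMode {m : ℕ} (h1 : 1 ≤ m) (h2 : m + 1 ≤ N) {c : ℝ} {d : ℂ} {x : Phase N}
    (hx : mode x (m + 1) = 0) (hcd : c ^ 2 + ‖d‖ ^ 2 = 1) (hn : ‖x‖ = 1) :
    ‖insertMode m c d x‖ = 1 := by
  have hsq : ‖insertMode m c d x‖ ^ 2 - ‖x‖ ^ 2 = 0 := by
    rw [norm_sq_eq_sum_act_of_lt _ (Nat.lt_succ_self N),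
      norm_sq_eq_sum_act_of_lt x (Nat.lt_succ_self N), ← Finset.sum_sub_distrib,
      Finset.sum_eq_add_of_mem m (m + 1) (Finset.mem_range.2 (by omega))
        (Finset.mem_range.2 (by omega)) (by omega)]
    · simp only [act, mode_insertMode h1 h2 hx, hx]
      simp only [if_true, Nat.succ_ne_self, if_false, norm_mul, mul_pow, Complex.norm_real,
        Real.norm_eq_abs, sq_abs, norm_zero]
      linear_combination ‖mode x m‖ ^ 2 * hcd
    · intro j _ hj
      simp [act, mode_insertMode h1 h2 hx, hj.1, hj.2]
  rw [hn] at hsq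
  nlinarith [norm_nonneg (insertMode m c d x)]

lemma mode_norm_le_norm (x : Phase N) (k : ℕ) : ‖mode x k‖ ≤ ‖x‖ := by
  have h := sum_four_act_le x k
  have h1 : act k x ≤ ‖x‖ ^ 2 := by
    linarith [act_nonneg (k + 1) x, act_nonneg (k + 2) x, act_nonneg (k + 3) x]
  exact (sq_le_sq₀ (norm_nonneg _) (norm_nonneg _)).1 h1

lemma dist_insertMode_le {m : ℕ} (h1 : 1 ≤ m) (h2 : m + 1 ≤ N) {c : ℝ} {d : ℂ} {x : Phase N}
    (hc : 0 ≤ c) (hcd : c ^ 2 + ‖d‖ ^ 2 = 1) (hn : ‖x‖ = 1) :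
    dist (insertMode m c d x) x ≤ 2 * ‖d‖ := by
  have hm : ‖mode x m‖ ≤ 1 := hn ▸ mode_norm_le_norm x m
  have hd0 := norm_nonneg d
  have hc1 : c ≤ 1 := by nlinarith [sq_nonneg ‖d‖]
  have hcd' : 1 - c ≤ ‖d‖ := by
    by_contra! hlt
    nlinarith
  rw [dist_eq_norm, insertMode, add_assoc, add_sub_cancel_left]
  refine (norm_add_le _ _).trans ?_
  rw [norm_smul, norm_smul, norm_unitVec h1 (by omega), norm_unitVec (by omega) h2, norm_mul,
    norm_mul, mul_one, mul_one]
  have e1 : ‖(c : ℂ) - 1‖ = 1 - c := by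
    rw [← Complex.ofReal_one, ← Complex.ofReal_sub, Complex.norm_real, Real.norm_eq_abs, abs_sub_comm,
      abs_of_nonneg (by linarith)]
  rw [e1]
  have e2 := mul_le_mul hcd' hm (norm_nonneg _) hd0
  have e3 := mul_le_mul_of_nonneg_left hm hd0
  linarith

end

section

variable {N : ℕ}

/-! ### From one circle to the next one -/

/-- The complex number whose conjugate has the components `(a η, η)` along the two bond
directions. -/
noncomputable def seed (η a : ℝ) : ℂ := ⟨(1 + a) * η / (2 * √3), (1 - a) * η / 2⟩

lemma norm_sq_seed (η a : ℝ) : ‖seed η a‖ ^ 2 = ((1 + a) ^ 2 / 12 + (1 - a) ^ 2 / 4) * η ^ 2 := by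
  have h3 : √3 ^ 2 = (3 : ℝ) := Real.sq_sqrt (by norm_num)
  have h30 : √3 ≠ 0 := by positivity
  rw [Complex.sq_norm, Complex.normSq_apply, seed]
  field_simp
  rw [h3]
  ring

lemma continuous_seed (η : ℝ) : Continuous (seed η) := by
  have h : seed η = fun a => (((1 + a) * η / (2 * √3) : ℝ) : ℂ)
      + (((1 - a) * η / 2 : ℝ) : ℂ) * Complex.I := by
    funext a
    exact Complex.mk_eq_add_mul_I _ _
  rw [h]
  fun_prop

/-- The mass is inserted at time `T₀` and the result is flowed back to time 0. This prescribes the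
right bond as a multiple of `(a, 1)` at `T₀`, when the second action will already have decayed,
while the initial point moves by at most `2 η exp (K T₀)`. -/
lemma exists_family {K : ℝ} {Φ : ℝ → Phase N → Phase N} (h : SphereFlow K Φ) {k : ℕ}
    (hN : k + 3 ≤ N) {γ : ℝ → Phase N} (hγ : Continuous γ) (hγn : ∀ s, ‖γ s‖ = 1)
    (hγs : ∀ s j, k + 2 < j → act j (γ s) = 0) (hγ1 : ∀ s, 0 < act (k + 1) (γ s))
    (hγ2 : ∀ s, 0 < act (k + 2) (γ s)) {T₀ η : ℝ} (hT₀ : 0 ≤ T₀) (hη : 0 < η)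
    (hη1 : η ≤ 1 / 10) :
    ∃ z : ℝ × ℝ → Phase N, Continuous z ∧ ∀ x, ‖z x‖ = 1 ∧
      (∀ j, k + 3 < j → act j (z x) = 0) ∧ 0 < act (k + 1) (z x) ∧ 0 < act (k + 2) (z x) ∧
      0 < act (k + 3) (z x) ∧ dist (z x) (γ x.1) ≤ 2 * η * Real.exp (K * T₀) ∧
      act (k + 3) (Φ T₀ (z x)) ≤ η ^ 2 ∧ 0 < bondV (k + 2) (Φ T₀ (z x)) ∧
      bondV (k + 2) (Φ T₀ (z x)) ≤ η ∧
      bondU (k + 2) (Φ T₀ (z x)) ^ 2 ≤ bondV (k + 2) (Φ T₀ (z x)) ^ 2 ∧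
      (99 / 100 < act (k + 2) (Φ T₀ (z x)) → η / 2 ≤ bondV (k + 2) (Φ T₀ (z x))) ∧
      (x.2 ≤ -1 → bondU (k + 2) (Φ T₀ (z x)) = -bondV (k + 2) (Φ T₀ (z x))) ∧
      (1 ≤ x.2 → bondU (k + 2) (Φ T₀ (z x)) = bondV (k + 2) (Φ T₀ (z x))) := by
  -- Clamping extends the family to the whole plane, as required by the planar separation lemma.
  let cl : ℝ → ℝ := fun a => max (-1) (min 1 a)
  have hcl : Continuous cl := by fun_prop
  have hcl1 : ∀ a, -1 ≤ cl a := fun a => le_max_left _ _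
  have hcl2 : ∀ a, cl a ≤ 1 := fun a => max_le (by norm_num) (min_le_left _ _)
  let d : ℝ → ℂ := fun a => seed η (cl a)
  have hd : Continuous d := (continuous_seed η).comp hcl
  have hdη : ∀ a, ‖d a‖ ^ 2 ≤ η ^ 2 := by
    intro a
    rw [norm_sq_seed]
    refine mul_le_of_le_one_left (sq_nonneg _) ?_
    nlinarith [hcl1 a, hcl2 a]
  have hd0 : ∀ a, 0 < ‖d a‖ ^ 2 := by
    intro a
    rw [norm_sq_seed]
    have : 0 < (1 + cl a) ^ 2 / 12 + (1 - cl a) ^ 2 / 4 := by nlinarith [sq_nonneg (cl a - 1 / 2)]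
    positivity
  have hdη' : ∀ a, ‖d a‖ ≤ η := fun a => (sq_le_sq₀ (norm_nonneg _) hη.le).1 (hdη a)
  have hη2 : η ^ 2 ≤ 1 / 100 := by nlinarith
  let c : ℝ → ℝ := fun a => √(1 - ‖d a‖ ^ 2)
  have hc : Continuous c := by fun_prop
  have hc2 : ∀ a, c a ^ 2 = 1 - ‖d a‖ ^ 2 := fun a => Real.sq_sqrt (by linarith [hdη a])
  have hcd : ∀ a, c a ^ 2 + ‖d a‖ ^ 2 = 1 := fun a => by rw [hc2]; ring
  have hc0 : ∀ a, 0 ≤ c a := fun a => Real.sqrt_nonneg _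
  have hc1 : ∀ a, c a ≤ 1 := fun a => by nlinarith [hcd a, sq_nonneg ‖d a‖]
  have hc9 : ∀ a, 9 / 10 ≤ c a := fun a => by nlinarith [hcd a, hdη a, hc0 a]
  let y₀ : ℝ × ℝ → Phase N := fun x => Φ T₀ (γ x.1)
  have hy₀c : Continuous y₀ := (h.continuous_space T₀).comp (hγ.comp continuous_fst)
  have hy₀n : ∀ x, ‖y₀ x‖ = 1 := fun x => h.norm _ _ (hγn _)
  have hy₀s : ∀ x j, k + 2 < j → act j (y₀ x) = 0 := fun x j hj =>
    h.act_eq_zero (hγn _) (hγs _ j hj) _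
  have hy₀m : ∀ x, mode (y₀ x) (k + 2 + 1) = 0 := fun x => by
    have := hy₀s x (k + 2 + 1) (by omega)
    simpa [act] using this
  let y : ℝ × ℝ → Phase N := fun x => insertMode (k + 2) (c x.2) (d x.2) (y₀ x)
  have hyc : Continuous y := by
    have h1 : Continuous fun x => mode (y₀ x) (k + 2) := (continuous_mode (k + 2)).comp hy₀c
    have h2 : Continuous fun x : ℝ × ℝ => ((c x.2 : ℝ) : ℂ) :=
      Complex.continuous_ofReal.comp (hc.comp continuous_snd)
    exact (hy₀c.add (((h2.sub continuous_const).mul h1).smul continuous_const)).add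
      (((hd.comp continuous_snd).mul h1).smul continuous_const)
  have hmode : ∀ x j, mode (y x) j = if j = k + 2 then (c x.2) * mode (y₀ x) (k + 2)
      else if j = k + 2 + 1 then d x.2 * mode (y₀ x) (k + 2) else mode (y₀ x) j := fun x j =>
    mode_insertMode (by omega) hN (hy₀m x) j
  have hyn : ∀ x, ‖y x‖ = 1 := fun x =>
    norm_insertMode (by omega) hN (hy₀m x) (hcd _) (hy₀n x)
  have hpos : ∀ x, 0 < act (k + 2) (y₀ x) := fun x => h.act_pos (hγn _) (hγ2 _) _
  have hle1 : ∀ x, act (k + 2) (y₀ x) ≤ 1 := fun x => by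
    have h1 := mode_norm_le_norm (y₀ x) (k + 2)
    rw [hy₀n] at h1
    exact pow_le_one₀ (norm_nonneg _) h1
  have hact2 : ∀ x, act (k + 2) (y x) = c x.2 ^ 2 * act (k + 2) (y₀ x) := fun x => by
    simp [act, hmode, mul_pow]
  have hact3 : ∀ x, act (k + 3) (y x) = ‖d x.2‖ ^ 2 * act (k + 2) (y₀ x) := fun x => by
    simp [act, hmode, mul_pow]
  have hbond : ∀ x, bond (k + 2) (y x) =
      ((c x.2 * act (k + 2) (y₀ x) : ℝ) : ℂ) * (starRingEnd ℂ) (d x.2) := fun x => by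
    have h1 := hmode x (k + 2)
    have h2 := hmode x (k + 2 + 1)
    simp only [if_true, Nat.succ_ne_self, if_false] at h1 h2
    rw [bond, h1, h2, map_mul, act]
    push_cast
    rw [← Complex.mul_conj']
    ring
  have h30 : √3 ≠ 0 := by positivity
  have hV : ∀ x, bondV (k + 2) (y x) = c x.2 * act (k + 2) (y₀ x) * η := fun x => by
    rw [bondV, hbond, Complex.re_ofReal_mul, Complex.im_ofReal_mul]
    simp only [d, seed, Complex.conj_re, Complex.conj_im]
    field_simp
    ring
  have hU : ∀ x, bondU (k + 2) (y x) = cl x.2 * bondV (k + 2) (y x) := fun x => by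
    rw [hV, bondU, hbond, Complex.re_ofReal_mul, Complex.im_ofReal_mul]
    simp only [d, seed, Complex.conj_re, Complex.conj_im]
    field_simp
    ring
  have hback : ∀ x, Φ T₀ (Φ (-T₀) (y x)) = y x := fun x => by
    rw [h.add, add_neg_cancel, h.zero]
  refine ⟨fun x => Φ (-T₀) (y x), (h.continuous_space _).comp hyc, fun x => ?_⟩
  rw [hback]
  have hVpos : 0 < bondV (k + 2) (y x) := by
    rw [hV]
    have := hpos x
    have : 0 < c x.2 := by linarith [hc9 x.2]
    positivity
  refine ⟨h.norm _ _ (hyn x), fun j hj => ?_, ?_, ?_, ?_, ?_, ?_, hVpos, ?_, ?_, ?_, ?_, ?_⟩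
  · refine h.act_eq_zero (hyn x) ?_ _
    rw [act, hmode, if_neg (by omega), if_neg (by omega)]
    exact hy₀s x j (by omega)
  · refine h.act_pos (hyn x) ?_ _
    rw [act, hmode, if_neg (by omega), if_neg (by omega)]
    exact h.act_pos (hγn _) (hγ1 _) _
  · refine h.act_pos (hyn x) ?_ _
    rw [hact2]
    have := hpos x
    have : 0 < c x.2 := by linarith [hc9 x.2]
    positivity
  · refine h.act_pos (hyn x) ?_ _
    rw [hact3]
    exact mul_pos (hd0 _) (hpos x)
  · have h1 := h.dist_le (-T₀) (y x) (y₀ x)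
    have h2 : Φ (-T₀) (y₀ x) = γ x.1 := by rw [h.add, neg_add_cancel, h.zero]
    rw [h2, abs_neg, abs_of_nonneg hT₀] at h1
    have h3 : dist (y x) (y₀ x) ≤ 2 * ‖d x.2‖ :=
      dist_insertMode_le (by omega) hN (hc0 _) (hcd _) (hy₀n x)
    exact h1.trans (mul_le_mul_of_nonneg_right (by linarith [hdη' x.2]) (Real.exp_pos _).le)
  · rw [hact3]
    exact (mul_le_of_le_one_right (sq_nonneg _) (hle1 x)).trans (hdη _)
  · rw [hV]
    have : c x.2 * act (k + 2) (y₀ x) ≤ 1 := mul_le_one₀ (hc1 _) (hpos x).le (hle1 x)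
    nlinarith
  · rw [hU, mul_pow]
    refine mul_le_of_le_one_left (sq_nonneg _) ?_
    nlinarith [hcl1 x.2, hcl2 x.2]
  · rw [hact2, hV]
    intro hgt
    have : 1 / 2 ≤ c x.2 * act (k + 2) (y₀ x) := by nlinarith [hc1 x.2, hpos x, hc0 x.2]
    nlinarith
  · intro hx
    rw [hU, show cl x.2 = -1 from ?_, neg_one_mul]
    simp only [cl]
    rw [min_eq_right (by linarith), max_eq_left hx]
  · intro hx
    rw [hU, show cl x.2 = 1 from ?_, one_mul]
    simp only [cl]
    rw [min_eq_left hx, max_eq_right (by norm_num)]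

/-- What happens to an orbit that stays near a circle for a long time, with the left bond in the
contracting cone. -/
lemma Passage.departure {A B M J u v p q : ℝ → ℝ} (h : Passage A B M J u v p q)
    {ρ δ T₀ τ w η a j : ℝ} (hρ : 0 < ρ) (hρ1 : ρ ≤ 1 / 100) (hδ1 : δ ≤ 1 / 100)
    (hρδ : ρ ≤ δ / 8) (hT₀ : 0 ≤ T₀) (hτ : 0 ≤ τ) (hw : 0 ≤ w)
    (hn1 : 16 * τ * Real.exp (-((2 * √3 - 20 * ρ) * T₀) + 28 * ρ * τ) ≤ 1 / 4)
    (hn2 : 2 * Real.exp (-((2 * √3 - 20 * ρ) * (T₀ + τ))) * Real.exp (4 * w) ≤ a)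
    (hn3 : 8 * a * w ≤ ρ) (hn4 : 24 * a * w ≤ η ^ 2 / 16)
    (hj : 0 < j) (hn5 : j ≤ η ^ 2 / 24 * Real.exp ((2 * √3 - 20 * ρ) * τ))
    (hn6 : 8 * η ^ 2 < δ / 2 * j) (hn7 : 1 < j * Real.exp (δ / 4 * w))
    (hη : 0 < η) (hJ : ∀ t, 0 < J t) (hq : 0 < q T₀) (hqη : q T₀ ≤ η)
    (hpq : p T₀ ^ 2 ≤ q T₀ ^ 2) (hqη' : 99 / 100 < M T₀ → η / 2 ≤ q T₀)
    (hM : ∀ t ∈ Icc 0 (T₀ + τ), 1 - ρ < M t)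
    (hcone : ∀ t ∈ Icc 0 (T₀ + τ), u t ^ 2 < 2 * v t ^ 2) :
    (∀ t ∈ Icc (T₀ + τ) (T₀ + τ + w), A t ≤ a ∧ 1 - 2 * ρ ≤ M t + J t ∧
      |p t * q t - p T₀ * q T₀| ≤ q T₀ ^ 2 / 4 + η ^ 2 / 16) ∧
    ∃ t ∈ Ico (T₀ + τ) (T₀ + τ + w), 1 - δ < J t ∧
      ∀ r ∈ Icc (T₀ + τ) t, 2 * |p r| < q r := by
  have hA := h.A_decay hρ1 hM hcone
  have hend : T₀ + τ ∈ Icc 0 (T₀ + τ) := ⟨by linarith, le_rfl⟩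
  have hq2 : η / 2 ≤ q T₀ := hqη' (by linarith [hM T₀ ⟨hT₀, by linarith⟩])
  obtain ⟨e1, e2, e3, e4⟩ := h.right_bond_estimates hT₀ (by linarith : T₀ ≤ T₀ + τ) hρ hρ1 hM hA hJ
    hq hpq (by rwa [add_sub_cancel_left])
  rw [add_sub_cancel_left] at e3
  have hdrift := h.drift (T₁ := T₀ + τ) (w := w) (a := a) (ρ := ρ) (k := η ^ 2 / 16)
    ((mul_le_mul_of_nonneg_right (hA _ hend) (Real.exp_pos _).le).trans hn2)
    (by linarith [hM _ hend, h.J_nonneg (T₀ + τ)]) hn3 hn4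
  have hdr : ∀ t ∈ Icc (T₀ + τ) (T₀ + τ + w),
      |p t * q t - p T₀ * q T₀| ≤ q T₀ ^ 2 / 4 + η ^ 2 / 16 := by
    intro t ht
    have h1 := (hdrift t ht).2.2
    have h2 := abs_sub_le (p t * q t) (p (T₀ + τ) * q (T₀ + τ)) (p T₀ * q T₀)
    linarith
  refine ⟨fun t ht => ⟨(hdrift t ht).1, (hdrift t ht).2.1, hdr t ht⟩, ?_⟩
  have hqq : q T₀ ^ 2 ≤ η ^ 2 := pow_le_pow_left₀ hq.le hqη 2
  refine h.exists_transit (k := η ^ 2) (j := j) hw hρδ hρ (fun t ht => (hdrift t ht).2.1) ?_ e1 e2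
    hj ?_ hn6 hn7 ?_
  · intro t ht
    have h1 := hdr t ht
    have h2 : |p T₀ * q T₀| ≤ q T₀ ^ 2 := by
      rw [abs_mul, pow_two, abs_of_pos hq]
      exact mul_le_mul_of_nonneg_right (abs_le_of_sq_le_sq hpq hq.le) hq.le
    have h3 := abs_sub_abs_le_abs_sub (p t * q t) (p T₀ * q T₀)
    nlinarith
  -- Here `q² ≤ 6 M J ≤ 6 J` and `q T₀² ≥ η² / 4`, which yields the constant `η² / 24`.
  · have h1 := h.right_le (T₀ + τ)
    have h2 : M (T₀ + τ) * J (T₀ + τ) ≤ 1 * J (T₀ + τ) := mul_le_mul_of_nonneg_right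
      (by linarith [h.mass (T₀ + τ), h.A_nonneg (T₀ + τ), h.B_nonneg (T₀ + τ),
        h.J_nonneg (T₀ + τ)]) (h.J_nonneg _)
    have h3 : η ^ 2 / 4 ≤ q T₀ ^ 2 := by nlinarith
    have h4 := mul_le_mul_of_nonneg_right h3 (Real.exp_pos ((2 * √3 - 20 * ρ) * τ)).le
    nlinarith [sq_nonneg (p (T₀ + τ))]
  · have h1 := hM _ hend
    have h2 := h.mass (T₀ + τ)
    have h3 := h.A_nonneg (T₀ + τ)
    have h4 := h.B_nonneg (T₀ + τ)
    linarith

end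

/-! ### Crossings and their propagation to the next circle. -/

section

variable {N : ℕ}

/-- The reachable points near the circle of the mode `k + 2` that are supported on the modes up to
`k + 2` and do not vanish in the mode `k + 1`. -/
def Staging (Φ : ℝ → Phase N → Phase N) (ε : ℝ) (k : ℕ) (δ : ℝ) : Set (Phase N) :=
  {y | ‖y‖ = 1 ∧ y ∈ Reach Φ ε ∧ (∀ j, k + 2 < j → act j y = 0) ∧ 1 - δ < act (k + 2) y ∧
    0 < act (k + 1) y}

/-- A path of reachable points near the circle of the mode `k + 2` that crosses the contracting
cone of the bond between the modes `k + 1` and `k + 2`. -/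
def Crossing (Φ : ℝ → Phase N → Phase N) (ε : ℝ) (k : ℕ) (δ : ℝ) : Prop :=
  ∃ x₀ x₁, JoinedIn (Staging Φ ε k δ) x₀ x₁ ∧ |bondV (k + 1) x₀| < -bondU (k + 1) x₀ ∧
    |bondV (k + 1) x₁| < bondU (k + 1) x₁

lemma Crossing.mono {Φ : ℝ → Phase N → Phase N} {ε : ℝ} {k : ℕ} {δ δ' : ℝ} (hδ : δ ≤ δ')
    (h : Crossing Φ ε k δ) : Crossing Φ ε k δ' := by
  obtain ⟨x₀, x₁, hj, h0, h1⟩ := h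
  exact ⟨x₀, x₁, hj.mono fun y ⟨a, b, c, d, e⟩ => ⟨a, b, c, by linarith, e⟩, h0, h1⟩

lemma joinedIn_of_orbit {K : ℝ} {Φ : ℝ → Phase N → Phase N} (h : SphereFlow K Φ) {y : Phase N}
    {S : Set (Phase N)} {s t : ℝ} (hst : s ≤ t) (hS : ∀ r ∈ Icc s t, Φ r y ∈ S) :
    JoinedIn S (Φ s y) (Φ t y) := by
  have h1 : IsPathConnected ((fun r => Φ r y) '' Icc s t) :=
    ((convex_Icc s t).isPathConnected ⟨s, left_mem_Icc.2 hst⟩).image (h.continuous_time y)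
  refine (h1.joinedIn _ ⟨s, left_mem_Icc.2 hst, rfl⟩ _ ⟨t, right_mem_Icc.2 hst, rfl⟩).mono ?_
  rintro _ ⟨r, hr, rfl⟩
  exact hS r hr

/-- The orbit is required to be still in `U` when it meets `V`. With `U` near the circle and `V` an
expanding cone, forward invariance of the cones then makes the two exit sets disjoint. -/
lemma isOpen_exitSet {K : ℝ} {Φ : ℝ → Phase N → Phase N} (h : SphereFlow K Φ)
    {z : ℝ × ℝ → Phase N} (hz : Continuous z) {U V : Set (Phase N)} (hU : IsOpen U)
    (hV : IsOpen V) (T : ℝ) :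
    IsOpen {x | ∃ t ∈ Icc 0 T, (∀ r ∈ Icc 0 t, Φ r (z x) ∈ U) ∧ Φ t (z x) ∈ V} := by
  have hc : Continuous fun y : ℝ × (ℝ × ℝ) => Φ y.1 (z y.2) :=
    h.continuous.comp (continuous_fst.prodMk (hz.comp continuous_snd))
  rw [isOpen_iff_mem_nhds]
  rintro x ⟨t, ht, h1, h2⟩
  have e1 := eventually_forall_flow_mem (g := fun t x => Φ t (z x)) hc hU h1
  have e2 : ∀ᶠ x' in 𝓝 x, Φ t (z x') ∈ V :=
    ((h.continuous_space t).comp hz).continuousAt.eventually (hV.mem_nhds h2)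
  filter_upwards [e1, e2] with x' h1' h2'
  exact ⟨t, ht, h1', h2'⟩

/-- A path of orbits that depart from the circle of the mode `k + 2` towards that of the mode
`k + 3`, on opposite sides of the heteroclinic connection at its two ends, yields a crossing. -/
lemma crossing_of_departing {K : ℝ} {Φ : ℝ → Phase N → Phase N} (h : SphereFlow K Φ) {ε : ℝ}
    {k : ℕ} {δ T₁ w τ a κ : ℝ} (hT₁ : 0 ≤ T₁) (hδ : 0 ≤ δ) (hδ1 : δ ≤ 1 / 100)
    (hτ : 0 ≤ τ) (hκ : 0 < κ) (hn1 : 48 * τ * (a * Real.exp (8 * δ * τ)) ≤ κ)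
    (hn2 : 6 * Real.exp (-(6 * τ)) < κ) {S : Set (Phase N)}
    (hSn : ∀ y ∈ S, ‖y‖ = 1) (hSr : S ⊆ Reach Φ ε)
    (hSs : ∀ y ∈ S, ∀ j, k + 3 < j → act j y = 0) (hS2 : ∀ y ∈ S, 0 < act (k + 2) y)
    (hnear : ∀ y ∈ S, ∀ t ∈ Icc 0 T₁, 1 / 4 < act (k + 2) (Φ t y))
    (hA : ∀ y ∈ S, ∀ t ∈ Icc T₁ (T₁ + w), act (k + 1) (Φ t y) ≤ a)
    (hmass : ∀ y ∈ S, ∀ t ∈ Icc T₁ (T₁ + w),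
      1 / 2 < act (k + 2) (Φ t y) + act (k + 3) (Φ t y))
    (htrans : ∀ y ∈ S, ∃ t ∈ Ico T₁ (T₁ + w), 1 - δ < act (k + 3) (Φ t y) ∧
      ∀ r ∈ Icc T₁ t, 2 * |bondU (k + 2) (Φ r y)| < bondV (k + 2) (Φ r y))
    {yb yt : Phase N} (hjoin : JoinedIn S yb yt)
    (hyb : ∀ t ∈ Icc T₁ (T₁ + w), 2 * κ ≤ -bondU (k + 2) (Φ t yb) * bondV (k + 2) (Φ t yb))
    (hyt : ∀ t ∈ Icc T₁ (T₁ + w), 2 * κ ≤ bondU (k + 2) (Φ t yt) * bondV (k + 2) (Φ t yt)) :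
    Crossing Φ ε (k + 1) δ := by
  have hP := fun y (hy : y ∈ S) => h.passage (hSn y hy) (hSs y hy)
  have hsup : ∀ y ∈ S, ∀ t ∈ Icc 0 (T₁ + w), 1 / 2 < supNorm (Φ t y) := by
    intro y hy t ht
    rcases le_total t T₁ with htT | htT
    · exact half_lt_supNorm (hnear y hy t ⟨ht.1, htT⟩)
    · have h1 := hmass y hy t ⟨htT, ht.2⟩
      by_cases h2 : 1 / 4 < act (k + 2) (Φ t y)
      · exact half_lt_supNorm h2
      · exact half_lt_supNorm (k := k + 3) (by linarith)
  have hstage : ∀ y ∈ S, ∀ t, 0 ≤ t → (∀ r ∈ Icc 0 t, 1 / 2 < supNorm (Φ r y)) →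
      1 - δ < act (k + 3) (Φ t y) → Φ t y ∈ Staging Φ ε (k + 1) δ := by
    intro y hy t ht hs hJ
    exact ⟨h.norm _ _ (hSn y hy), Reach.flow h (hSr hy) ht hs,
      fun i hi => h.act_eq_zero (hSn y hy) (hSs y hy i (by omega)) t, hJ,
      h.act_pos (hSn y hy) (hS2 y hy) t⟩
  -- Admissible arrival times. They form an interval: while `q` dominates `p`, the last action does
  -- not decrease.
  let G : Phase N → Set ℝ := fun y => {t | t ∈ Ico T₁ (T₁ + w) ∧ 1 - δ < act (k + 3) (Φ t y) ∧
    ∀ r ∈ Icc T₁ t, 2 * |bondU (k + 2) (Φ r y)| < bondV (k + 2) (Φ r y)}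
  have hG : ∀ y ∈ S, Convex ℝ (G y) := by
    intro y hy
    refine OrdConnected.convex ⟨fun s hs t ht r hr => ?_⟩
    refine ⟨⟨hs.1.1.trans hr.1, hr.2.trans_lt ht.1.2⟩, hs.2.1.trans_le ?_,
      fun r' hr' => ht.2.2 r' ⟨hr'.1, hr'.2.trans hr.2⟩⟩
    refine le_of_deriv_nonneg hr.1 fun t' => ⟨_, (hP y hy).deriv_J t', fun ht' => ?_⟩
    have h1 := ht.2.2 t' ⟨hs.1.1.trans ht'.1.le, ht'.2.le.trans hr.2⟩
    have h2 : bondU (k + 2) (Φ t' y) ^ 2 ≤ bondV (k + 2) (Φ t' y) ^ 2 := by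
      rw [← sq_abs (bondU _ _)]
      exact pow_le_pow_left₀ (abs_nonneg _)
        (by linarith [abs_nonneg (bondU (k + 2) (Φ t' y))]) 2
    have h3 := two_div_sqrt_three_bounds.1
    nlinarith
  let π := hjoin.somePath
  have hπ : ∀ i, π i ∈ S := hjoin.somePath_mem
  -- An admissible time remains admissible for nearby orbits. Convexity therefore gives a continuous
  -- choice of arrival time along the path.
  obtain ⟨g, hg⟩ := exists_continuous_forall_mem_convex_of_local_const
    (t := fun i : unitInterval => G (π i)) (fun i => hG _ (hπ i)) (by
      intro i
      obtain ⟨t, ht, htJ, htc⟩ := htrans _ (hπ i)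
      refine ⟨t, ?_⟩
      have hcπ : Continuous fun y : ℝ × unitInterval => Φ y.1 (π y.2) :=
        h.continuous.comp (continuous_fst.prodMk (π.continuous.comp continuous_snd))
      have e1 := eventually_forall_flow_mem (g := fun t i => Φ t (π i)) hcπ
        (isOpen_lt (continuous_const.mul (continuous_bondU (k + 2)).abs) (continuous_bondV _))
        htc
      have e2 : ∀ᶠ i' in 𝓝 i, 1 - δ < act (k + 3) (Φ t (π i')) :=
        ((continuous_act _).comp ((h.continuous_space t).comp π.continuous)).continuousAt.eventually
          (lt_mem_nhds htJ)
      filter_upwards [e1, e2] with i' h1 h2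
      exact ⟨ht, h2, h1⟩)
  have hmid : JoinedIn (Staging Φ ε (k + 1) δ) (Φ (g 0) yb) (Φ (g 1) yt) := by
    refine ⟨⟨⟨fun i => Φ (g i) (π i), ?_⟩, by simp [π], by simp [π]⟩, fun i => ?_⟩
    · exact h.continuous.comp (g.continuous.prodMk π.continuous)
    · exact hstage _ (hπ i) _ (hT₁.trans (hg i).1.1)
        (fun r hr => hsup _ (hπ i) r ⟨hr.1, hr.2.trans (hg i).1.2.le⟩) (hg i).2.1
  have hybS : yb ∈ S := hjoin.source_mem
  have hytS : yt ∈ S := hjoin.target_mem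
  have hgb : g 0 ∈ G yb := by simpa [π] using hg 0
  have hgt : g 1 ∈ G yt := by simpa [π] using hg 1
  have hq : ∀ y, ∀ t ∈ G y, 0 < bondV (k + 2) (Φ t y) := fun y t ht => by
    have := ht.2.2 t ⟨ht.1.1, le_rfl⟩
    linarith [abs_nonneg (bondU (k + 2) (Φ t y))]
  have htail : ∀ y ∈ S, ∀ s ∈ G y, ∀ t, s ≤ t → (∀ r ∈ Icc s t, 1 - δ < act (k + 3) (Φ r y)) →
      JoinedIn (Staging Φ ε (k + 1) δ) (Φ s y) (Φ t y) := by
    intro y hy s hs t hst hJ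
    refine joinedIn_of_orbit h hst fun r hr => ?_
    refine hstage y hy r (hT₁.trans (hs.1.1.trans hr.1)) (fun r' hr' => ?_) (hJ r hr)
    rcases le_total r' s with hr's | hr's
    · exact hsup y hy r' ⟨hr'.1, hr's.trans hs.1.2.le⟩
    · exact half_lt_supNorm (k := k + 3) (by linarith [hJ r' ⟨hr's, hr'.2.trans hr.2⟩])
  -- Each end is followed until it enters its cone; these two pieces of orbit are attached to the
  -- path of arrival points.
  obtain ⟨tb, htb, hJb, hcb⟩ := (hP yb hybS).neg_p.exists_exit hτ hδ hδ1
    (hA yb hybS _ ⟨hgb.1.1, hgb.1.2.le⟩) hκ (hyb _ ⟨hgb.1.1, hgb.1.2.le⟩)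
    (hq yb _ hgb) hgb.2.1 hn1 hn2
  obtain ⟨tt, htt, hJt, hct⟩ := (hP yt hytS).exists_exit hτ hδ hδ1
    (hA yt hytS _ ⟨hgt.1.1, hgt.1.2.le⟩) hκ (hyt _ ⟨hgt.1.1, hgt.1.2.le⟩)
    (hq yt _ hgt) hgt.2.1 hn1 hn2
  exact ⟨Φ tb yb, Φ tt yt, ((htail yb hybS _ hgb tb htb hJb).symm.trans hmid).trans
    (htail yt hytS _ hgt tt htt hJt), hcb, hct⟩

/-- Among the orbits of the two-parameter family, those that leave through neither cone contain a
path between the seedings `U = -V` and `U = V` of the outgoing bond; `crossing_of_departing` applies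
to it. -/
theorem Crossing.step {K : ℝ} {Φ : ℝ → Phase N → Phase N} (h : SphereFlow K Φ) (hK : 0 ≤ K)
    {ε : ℝ} {k : ℕ} (hN : k + 3 ≤ N) (ih : ∀ δ, 0 < δ → Crossing Φ ε k δ) {δ : ℝ} (hδ : 0 < δ)
    (hδK : δ * (100 * (K + 8)) ≤ 1) : Crossing Φ ε (k + 1) δ := by
  have hδ1 : δ ≤ 1 / 100 := by nlinarith
  obtain ⟨ρ, hρ, hρK⟩ : ∃ ρ, 0 < ρ ∧ ρ * (8000 * (K + 8)) = δ :=
    ⟨δ / (8000 * (K + 8)), by positivity, by field_simp⟩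
  have hρδ : ρ ≤ δ / 8 := by nlinarith
  have hρ1 : ρ ≤ 1 / 100 := by linarith
  obtain ⟨x₀, x₁, hjoin, hx₀, hx₁⟩ := ih (ρ / 4) (by positivity)
  let γ : ℝ → Phase N := hjoin.somePath.extend
  have hγ : Continuous γ := hjoin.somePath.continuous_extend
  have hγmem : ∀ s, γ s ∈ Staging Φ ε k (ρ / 4) := fun s => hjoin.somePath_mem _
  let Ω : Set (Phase N) := Reach Φ ε ∩ {y | 1 - ρ / 4 < act (k + 2) y}
  have hΩ : IsOpen Ω := (isOpen_reach h ε).inter (isOpen_lt continuous_const (continuous_act _))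
  have hγc : IsCompact (range hjoin.somePath) := isCompact_range hjoin.somePath.continuous
  obtain ⟨R₁, hR₁, hR₁Ω⟩ := hγc.exists_thickening_subset_open hΩ (by
    rintro _ ⟨s, rfl⟩
    obtain ⟨-, h2, -, h4, -⟩ := hjoin.somePath_mem s
    exact ⟨h2, h4⟩)
  let Vm : Set (Phase N) := {y | |bondV (k + 1) y| < -bondU (k + 1) y}
  let Vp : Set (Phase N) := {y | |bondV (k + 1) y| < bondU (k + 1) y}
  have hVm : IsOpen Vm := isOpen_lt (continuous_bondV _).abs (continuous_bondU _).neg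
  have hVp : IsOpen Vp := isOpen_lt (continuous_bondV _).abs (continuous_bondU _)
  obtain ⟨R₂, hR₂, hR₂V⟩ := Metric.isOpen_iff.1 hVm x₀ hx₀
  obtain ⟨R₃, hR₃, hR₃V⟩ := Metric.isOpen_iff.1 hVp x₁ hx₁
  -- The distances `R₁`, `R₂`, `R₃` depend on the given path, so the times and the inserted mass are
  -- chosen only now.
  obtain ⟨T₀, τ, w, η, a, j, hT₀, hτ, hw, hη, hη1, n1, n2, n3, n4, n5, n6, n7, n8, hj, n9, n10,
    n11, n12⟩ := exists_parameters hK hρ hρK hδK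
      (R := min R₁ (min R₂ R₃)) (lt_min hR₁ (lt_min hR₂ hR₃))
  obtain ⟨z, hz, hfam⟩ := exists_family h hN hγ (fun s => (hγmem s).1)
    (fun s => (hγmem s).2.2.1) (fun s => (hγmem s).2.2.2.2)
    (fun s => by linarith [(hγmem s).2.2.2.1]) hT₀ hη hη1
  have hP := fun x => h.passage (hfam x).1 (hfam x).2.1
  have hzn : ∀ x, ‖z x‖ = 1 := fun x => (hfam x).1
  have hdist : ∀ x, dist (z x) (γ x.1) < min R₁ (min R₂ R₃) := fun x =>
    (hfam x).2.2.2.2.2.1.trans_lt n12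
  have hzΩ : ∀ x, z x ∈ Ω := fun x => hR₁Ω (Metric.mem_thickening_iff.2
    ⟨γ x.1, mem_range_self _, (hdist x).trans_le (min_le_left _ _)⟩)
  set T₁ := T₀ + τ with hT₁
  have hT₁0 : 0 ≤ T₁ := by linarith
  let U : Set (Phase N) := {y | 1 - ρ < act (k + 2) y}
  have hU : IsOpen U := isOpen_lt continuous_const (continuous_act _)
  -- The cone `U² < 2 V²` is open and contains the closed one `U² ≤ V²`, apart from `U = V = 0`,
  -- which the positive actions exclude. Thus `O` is an open neighbourhood of the parameters that
  -- avoid both exits.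
  let O : Set (ℝ × ℝ) := {x | ∀ t ∈ Icc 0 T₁, Φ t (z x) ∈
    U ∩ {y | bondU (k + 1) y ^ 2 < 2 * bondV (k + 1) y ^ 2}}
  have hc : Continuous fun y : ℝ × (ℝ × ℝ) => Φ y.1 (z y.2) :=
    h.continuous.comp (continuous_fst.prodMk (hz.comp continuous_snd))
  have hO : IsOpen O := by
    rw [isOpen_iff_mem_nhds]
    intro x hx
    exact eventually_forall_flow_mem (g := fun t x => Φ t (z x)) hc (hU.inter
      (isOpen_lt ((continuous_bondU _).pow 2) (continuous_const.mul ((continuous_bondV _).pow 2))))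
      hx
  have hz0 : ∀ x, z x ∈ U := fun x => by
    have : 1 - ρ / 4 < act (k + 2) (z x) := (hzΩ x).2
    change 1 - ρ < act (k + 2) (z x)
    linarith
  obtain ⟨xb, xt, hxb, hxt, hjO⟩ := exists_joinedIn_of_separates
    (isOpen_exitSet h hz hU hVm T₁) (isOpen_exitSet h hz hU hVp T₁) hO
    (by
      rw [Set.disjoint_left]
      rintro x ⟨s, hs, hs1, hs2⟩ ⟨t, ht, ht1, ht2⟩
      have hUM : ∀ y ∈ U, 99 / 100 < act (k + 2) y := fun y hy => by
        have : 1 - ρ < act (k + 2) y := hy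
        linarith
      rcases le_total s t with hst | hst
      · have h1 := (hP x).abs_v_lt_neg_u hst
          (fun r hr => hUM _ (ht1 r ⟨hs.1.trans hr.1.le, hr.2.le⟩)) hs2
        have h2 : |bondV (k + 1) (Φ t (z x))| < bondU (k + 1) (Φ t (z x)) := ht2
        linarith [abs_nonneg (bondV (k + 1) (Φ t (z x)))]
      · have h1 := (hP x).abs_v_lt_u hst
          (fun r hr => hUM _ (hs1 r ⟨ht.1.trans hr.1.le, hr.2.le⟩)) ht2
        have h2 : |bondV (k + 1) (Φ s (z x))| < -bondU (k + 1) (Φ s (z x)) := hs2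
        linarith [abs_nonneg (bondV (k + 1) (Φ s (z x)))])
    (by
      intro x hxm hxp
      obtain ⟨-, -, hA0, hM0, -, -, f1, f2, f3, f4, -⟩ := hfam x
      have hcone : ∀ t ∈ Icc 0 T₁, (∀ r ∈ Icc 0 t, 1 - ρ < act (k + 2) (Φ r (z x))) →
          bondU (k + 1) (Φ t (z x)) ^ 2 ≤ bondV (k + 1) (Φ t (z x)) ^ 2 := by
        intro t ht hr
        have h1 : ¬ |bondV (k + 1) (Φ t (z x))| < -bondU (k + 1) (Φ t (z x)) := fun hlt =>
          hxm ⟨t, ht, hr, hlt⟩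
        have h2 : ¬ |bondV (k + 1) (Φ t (z x))| < bondU (k + 1) (Φ t (z x)) := fun hlt =>
          hxp ⟨t, ht, hr, hlt⟩
        rw [sq_le_sq]
        exact abs_le.2 ⟨by linarith, by linarith⟩
      have hM := (hP x).forall_M_gt (T₁ := T₁) hT₀ hρ hρ1
        (by
          have : 1 - ρ / 4 < act (k + 2) (z x) := (hzΩ x).2
          simpa [h.zero] using this.le)
        ((mul_le_mul_of_nonneg_right f1 (Real.exp_pos _).le).trans n1)
        (by
          rw [hT₁, add_sub_cancel_left]
          refine (mul_le_mul_of_nonneg_right ?_ (Real.exp_pos _).le).trans n2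
          have := pow_le_pow_left₀ f2.le f3 2
          linarith) hcone
      intro t ht
      refine ⟨hM t ht, ?_⟩
      have h1 := hcone t ht fun r hr => hM r ⟨hr.1, hr.2.trans ht.2⟩
      have h2 := (hP x).left_ge t
      have h3 := mul_pos (h.act_pos (hzn x) hA0 t) (h.act_pos (hzn x) hM0 t)
      change bondU (k + 1) (Φ t (z x)) ^ 2 < 2 * bondV (k + 1) (Φ t (z x)) ^ 2
      linarith)
    (by
      intro x hx
      refine ⟨0, ⟨le_rfl, hT₁0⟩, fun r hr => ?_, ?_⟩
      · rw [le_antisymm hr.2 hr.1, h.zero]; exact hz0 x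
      · rw [h.zero]
        refine hR₂V (Metric.mem_ball.2 ?_)
        have := hdist x
        rw [show γ x.1 = x₀ from hjoin.somePath.extend_of_le_zero hx] at this
        exact this.trans_le ((min_le_right _ _).trans (min_le_left _ _)))
    (by
      intro x hx
      refine ⟨0, ⟨le_rfl, hT₁0⟩, fun r hr => ?_, ?_⟩
      · rw [le_antisymm hr.2 hr.1, h.zero]; exact hz0 x
      · rw [h.zero]
        refine hR₃V (Metric.mem_ball.2 ?_)
        have := hdist x
        rw [show γ x.1 = x₁ from hjoin.somePath.extend_of_one_le hx] at this
        exact this.trans_le ((min_le_right _ _).trans (min_le_right _ _)))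
  have hdep : ∀ x ∈ O, _ := fun x hx => (hP x).departure hρ hρ1 hδ1 hρδ hT₀ hτ hw n3 n4 n5 n6
    hj n9 n10 n11 hη (fun t => h.act_pos (hzn x) (hfam x).2.2.2.2.1 t)
    (hfam x).2.2.2.2.2.2.2.1 (hfam x).2.2.2.2.2.2.2.2.1 (hfam x).2.2.2.2.2.2.2.2.2.1
    (hfam x).2.2.2.2.2.2.2.2.2.2.1 (fun t ht => (hx t ht).1) (fun t ht => (hx t ht).2)
  have hq0 : ∀ x ∈ O, η / 2 ≤ bondV (k + 2) (Φ T₀ (z x)) := fun x hx => by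
    refine (hfam x).2.2.2.2.2.2.2.2.2.2.1 ?_
    have : 1 - ρ < act (k + 2) (Φ T₀ (z x)) := (hx T₀ ⟨hT₀, by linarith⟩).1
    linarith
  have hjz : JoinedIn (z '' O) (z xb) (z xt) :=
    ⟨hjO.somePath.map hz, fun i => mem_image_of_mem z (hjO.somePath_mem i)⟩
  refine crossing_of_departing h (T₁ := T₁) (w := w) (τ := τ) (a := a) (κ := η ^ 2 / 16) hT₁0 hδ.le
    hδ1 hτ (by positivity) n7 n8 ?_ ?_ ?_ ?_ ?_ ?_ ?_ ?_ hjz ?_ ?_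
  · rintro _ ⟨x, -, rfl⟩
    exact hzn x
  · rintro _ ⟨x, -, rfl⟩
    exact (hzΩ x).1
  · rintro _ ⟨x, -, rfl⟩
    exact (hfam x).2.1
  · rintro _ ⟨x, -, rfl⟩
    exact (hfam x).2.2.2.1
  · rintro _ ⟨x, hx, rfl⟩ t ht
    have : 1 - ρ < act (k + 2) (Φ t (z x)) := (hx t ht).1
    linarith
  · rintro _ ⟨x, hx, rfl⟩ t ht
    exact ((hdep x hx).1 t ht).1
  · rintro _ ⟨x, hx, rfl⟩ t ht
    have := ((hdep x hx).1 t ht).2.1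
    linarith
  · rintro _ ⟨x, hx, rfl⟩
    exact (hdep x hx).2
  -- At `T₀` the product is `∓q²` with `q ≥ η / 2`. The drift is at most `q² / 4 + η² / 16`, which
  -- leaves at least `3 η² / 16 - η² / 16 = 2 κ` in modulus.
  · intro t ht
    have h1 := (abs_le.1 ((hdep xb hjO.source_mem).1 t ht).2.2).2
    rw [(hfam xb).2.2.2.2.2.2.2.2.2.2.2.1 hxb] at h1
    nlinarith [hq0 xb hjO.source_mem]
  · intro t ht
    have h1 := (abs_le.1 ((hdep xt hjO.target_mem).1 t ht).2.2).1
    rw [(hfam xt).2.2.2.2.2.2.2.2.2.2.2.2 hxt] at h1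
    nlinarith [hq0 xt hjO.target_mem]

end

section

variable {N : ℕ}

/-! ### The chain of circles -/

lemma norm_sq_sub_norm_sq {x y : Phase N} {j : ℕ} (h1 : j ≤ N)
    (h : ∀ k, k ≠ j → mode x k = mode y k) :
    ‖x‖ ^ 2 - ‖y‖ ^ 2 = act j x - act j y := by
  rw [norm_sq_eq_sum_act_of_lt x (Nat.lt_succ_self N),
    norm_sq_eq_sum_act_of_lt y (Nat.lt_succ_self N), ← Finset.sum_sub_distrib,
    Finset.sum_eq_single_of_mem j (Finset.mem_range.2 (by omega))]
  intro k _ hk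
  simp [act, h k hk]

/-- Crossings exist near the third circle. -/
lemma crossing_third_circle {K : ℝ} {Φ : ℝ → Phase N → Phase N} (h : SphereFlow K Φ) (hN : 3 ≤ N)
    {ε δ : ℝ} (hε : 0 < ε) (hδ : 0 < δ) : Crossing Φ ε 1 δ := by
  obtain ⟨η, hη, hη2⟩ : ∃ η : ℝ, 0 < η ∧ 3 * η ^ 2 < min (min ε δ) (1 / 2) := by
    have h0 : 0 < min (min ε δ) (1 / 2) := by positivity
    refine ⟨√(min (min ε δ) (1 / 2) / 4), by positivity, ?_⟩
    rw [Real.sq_sqrt (by positivity)]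
    linarith
  have hηε := hη2.trans_le ((min_le_left _ _).trans (min_le_left _ _))
  have hηδ := hη2.trans_le ((min_le_left _ _).trans (min_le_right _ _))
  have hη12 := hη2.trans_le (min_le_right _ _)
  let c : ℝ → ℝ := fun a => √(1 - ‖seed η a‖ ^ 2)
  have hcc : Continuous c := by
    have := continuous_seed η
    fun_prop
  let y : ℝ → Phase N := fun a =>
    ((starRingEnd ℂ) (seed η a)) • unitVec N 2 + ((c a : ℝ) : ℂ) • unitVec N 3
  have hy : Continuous y :=
    ((Complex.continuous_conj.comp (continuous_seed η)).smul continuous_const).add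
      ((Complex.continuous_ofReal.comp hcc).smul continuous_const)
  have hmode : ∀ a j, mode (y a) j = if j = 2 then (starRingEnd ℂ) (seed η a)
      else if j = 3 then ((c a : ℝ) : ℂ) else 0 := by
    intro a j
    simp only [y]
    rw [mode_add, mode_csmul, mode_csmul, mode_unitVec (by norm_num) (by omega),
      mode_unitVec (by norm_num) hN]
    by_cases h2 : j = 2
    · simp [h2]
    · by_cases h3 : j = 3 <;> simp [h2, h3]
  have hs0 : ∀ a, 0 < ‖seed η a‖ ^ 2 := fun a => by
    rw [norm_sq_seed]
    have : 0 < (1 + a) ^ 2 / 12 + (1 - a) ^ 2 / 4 := by nlinarith [sq_nonneg (a - 1 / 2)]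
    positivity
  have hs1 : ∀ a ∈ Icc (-2 : ℝ) 2, ‖seed η a‖ ^ 2 ≤ 3 * η ^ 2 := fun a ha => by
    rw [norm_sq_seed]
    refine mul_le_mul_of_nonneg_right ?_ (sq_nonneg _)
    nlinarith [ha.1, ha.2]
  have hc2 : ∀ a ∈ Icc (-2 : ℝ) 2, c a ^ 2 = 1 - ‖seed η a‖ ^ 2 := fun a ha =>
    Real.sq_sqrt (by linarith [hs1 a ha])
  have hact2 : ∀ a, act 2 (y a) = ‖seed η a‖ ^ 2 := fun a => by
    rw [act, hmode]; simp
  have hact3 : ∀ a ∈ Icc (-2 : ℝ) 2, act 3 (y a) = 1 - ‖seed η a‖ ^ 2 := fun a ha => by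
    rw [← hc2 a ha, act, hmode]; simp
  -- Explicit points with modes 2 and 3 only, reachable in time 0. Since `U = a V`, the range `[-2,
  -- 2]` puts both ends strictly inside the cones.
  have hstage : ∀ a ∈ Icc (-2 : ℝ) 2, y a ∈ Staging Φ ε 1 δ := by
    intro a ha
    have h3 := hact3 a ha
    have hle := hs1 a ha
    refine ⟨?_, ⟨0, le_rfl, ?_, fun t ht => ?_⟩, fun j hj => ?_, ?_, ?_⟩
    · have hsq : ‖y a‖ ^ 2 = 1 := by
        rw [norm_sq_eq_sum_act_of_lt _ (Nat.lt_succ_self N),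
          Finset.sum_eq_add_of_mem 2 3 (Finset.mem_range.2 (by omega))
            (Finset.mem_range.2 (by omega)) (by norm_num), hact2, h3]
        · ring
        · intro j _ hj
          simp [act, hmode, hj.1, hj.2]
      nlinarith [norm_nonneg (y a)]
    · rw [neg_zero, h.zero, h3]; linarith
    · rw [le_antisymm ht.2 ht.1, neg_zero, h.zero]
      exact half_lt_supNorm (k := 3) (by rw [h3]; linarith)
    · rw [act, hmode, if_neg (by omega), if_neg (by omega)]; simp
    · rw [h3]; linarith
    · rw [hact2]; exact hs0 a
  have hbond : ∀ a, bond 2 (y a) = ((c a : ℝ) : ℂ) * (starRingEnd ℂ) (seed η a) := fun a => by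
    rw [bond, hmode, hmode]
    simp [mul_comm]
  have h30 : √3 ≠ 0 := by positivity
  have hV : ∀ a, bondV 2 (y a) = c a * η := fun a => by
    rw [bondV, hbond, Complex.re_ofReal_mul, Complex.im_ofReal_mul]
    simp only [seed, Complex.conj_re, Complex.conj_im]
    field_simp
    ring
  have hU : ∀ a, bondU 2 (y a) = a * (c a * η) := fun a => by
    rw [bondU, hbond, Complex.re_ofReal_mul, Complex.im_ofReal_mul]
    simp only [seed, Complex.conj_re, Complex.conj_im]
    field_simp
    ring
  have hpos : ∀ a ∈ Icc (-2 : ℝ) 2, 0 < c a * η := fun a ha =>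
    mul_pos (Real.sqrt_pos.2 (by linarith [hs1 a ha])) hη
  have hm2 : (-2 : ℝ) ∈ Icc (-2 : ℝ) 2 := by norm_num
  have hp2 : (2 : ℝ) ∈ Icc (-2 : ℝ) 2 := by norm_num
  refine ⟨y (-2), y 2, ?_, ?_, ?_⟩
  · have hpc : IsPathConnected (y '' Icc (-2) 2) :=
      ((convex_Icc (-2 : ℝ) 2).isPathConnected ⟨_, hm2⟩).image hy
    refine (hpc.joinedIn _ ⟨_, hm2, rfl⟩ _ ⟨_, hp2, rfl⟩).mono ?_
    rintro _ ⟨a, ha, rfl⟩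
    exact hstage a ha
  · have := hpos _ hm2
    rw [hU, hV, abs_of_pos this]
    linarith
  · have := hpos _ hp2
    rw [hU, hV, abs_of_pos this]
    linarith

lemma crossing_all {K : ℝ} {Φ : ℝ → Phase N → Phase N} (h : SphereFlow K Φ) (hK : 0 ≤ K) {ε : ℝ}
    (hε : 0 < ε) {k : ℕ} (hk : 1 ≤ k) :
    k + 2 ≤ N → ∀ δ, 0 < δ → Crossing Φ ε k δ := by
  induction k, hk using Nat.le_induction with
  | base => exact fun hN δ hδ => crossing_third_circle h hN hε hδ
  | succ k _ ih =>
    intro hN δ hδ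
    refine Crossing.mono (min_le_left δ (1 / (100 * (K + 8)))) ?_
    refine Crossing.step h hK (by omega) (ih (by omega)) (by positivity) ?_
    have := mul_le_mul_of_nonneg_right (min_le_right δ (1 / (100 * (K + 8))))
      (by positivity : 0 ≤ 100 * (K + 8))
    rwa [one_div_mul_cancel (by positivity)] at this

/-- A point of the sphere whose mass is concentrated in one mode is close to a circle. -/
lemma near_circle {x : massSphere N} {j : ℕ} (hj1 : 1 ≤ j) (hjN : j ≤ N) {ε e : ℝ} (hε : 0 < ε)
    (he1 : e ≤ 1 / 2) (heε : e ≤ ε) (he : 2 * e < ε ^ 2) (hx : 1 - e < act j (x : Phase N)) :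
    (∃ p ∈ circle N j, dist x p < ε) ∧ 1 - ε ≤ ‖mode (x : Phase N) j‖ ∧
      ∀ k, k ≠ j → ‖mode (x : Phase N) k‖ ≤ ε := by
  obtain ⟨x, hxs⟩ := x
  have hn : ‖x‖ = 1 := by simpa using hxs
  simp only at hx ⊢
  have hb1 : ‖mode x j‖ ≤ 1 := hn ▸ mode_norm_le_norm x j
  have hb0 := norm_nonneg (mode x j)
  have hb : 1 - e < ‖mode x j‖ := by rw [act] at hx; nlinarith
  have hbpos : 0 < ‖mode x j‖ := by linarith
  refine ⟨?_, by linarith, fun k hk => ?_⟩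
  · set ζ : ℂ := mode x j / ‖mode x j‖ with hζ
    have hζn : ‖ζ‖ = 1 := by
      rw [hζ, norm_div, Complex.norm_real, norm_norm, div_self hbpos.ne']
    have hmode : ∀ k, mode (ζ • unitVec N j) k = if k = j then ζ else 0 := fun k => by
      rw [mode_csmul, mode_unitVec hj1 hjN]; simp
    have hpn : ‖ζ • unitVec N j‖ = 1 := by rw [norm_smul, hζn, norm_unitVec hj1 hjN, one_mul]
    refine ⟨⟨ζ • unitVec N j, by simpa using hpn⟩, ⟨?_, fun k hk => ?_⟩, ?_⟩
    · simp only [hmode, if_true, hζn]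
    · simp only [hmode, hk, if_false]
    · rw [Subtype.dist_eq, dist_eq_norm]
      have hsub : x - ζ • unitVec N j = x + (-ζ) • unitVec N j := by
        rw [neg_smul, sub_eq_add_neg]
      have hm : ∀ k, mode (x - ζ • unitVec N j) k = mode x k + if k = j then -ζ else 0 := by
        intro k
        rw [hsub, mode_add, mode_csmul, mode_unitVec hj1 hjN]; simp
      have h1 := norm_sq_sub_norm_sq (x := x - ζ • unitVec N j) (y := x) hjN
        fun k hk => by simp [hm, hk]
      have h2 : act j (x - ζ • unitVec N j) = (1 - ‖mode x j‖) ^ 2 := by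
        rw [act, hm, if_pos rfl]
        have : mode x j + -ζ = -(((1 - ‖mode x j‖ : ℝ) : ℂ) * ζ) := by
          have h3 : (‖mode x j‖ : ℂ) * ζ = mode x j := by
            rw [hζ]
            have : (‖mode x j‖ : ℂ) ≠ 0 := by exact_mod_cast hbpos.ne'
            field_simp
          push_cast
          linear_combination -h3
        rw [this, norm_neg, norm_mul, hζn, mul_one, Complex.norm_real, Real.norm_eq_abs, sq_abs]
      rw [h2, hn, act] at h1
      -- The squared distance equals `2 - 2 ‖mode x j‖`, which is below `2 e`.
      refine lt_of_pow_lt_pow_left₀ 2 hε.le ?_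
      nlinarith
  · have h1 := norm_sq_sub_norm_sq (x := x) (y := x + (-mode x j) • unitVec N j) hjN
      fun i hi => by rw [mode_add, mode_csmul, mode_unitVec hj1 hjN, if_neg hi]; simp
    have h2 : act j (x + (-mode x j) • unitVec N j) = 0 := by
      rw [act, mode_add, mode_csmul, mode_unitVec hj1 hjN]; simp
    have h3 := mode_norm_le_norm (x + (-mode x j) • unitVec N j) k
    rw [mode_add, mode_csmul, mode_unitVec hj1 hjN, if_neg hk, mul_zero, add_zero] at h3
    rw [h2, hn] at h1
    refine le_of_sq_le_sq ?_ hε.le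
    nlinarith [norm_nonneg (mode x k), pow_le_pow_left₀ (norm_nonneg _) h3 2]

lemma supNorm_le_norm (x : Phase N) : supNorm x ≤ ‖x‖ :=
  (pi_norm_le_iff_of_nonneg (norm_nonneg _)).2 fun i => PiLp.norm_apply_le x i

end

end ToyModel


theorem theorem3p1 :
    ∃ c C : ℝ, 0 < c ∧ 0 < C ∧
      ∀ N : ℕ, 6 ≤ N → ∀ ε : ℝ, 0 < ε →
        ∃ (x y : ToyModel.massSphere N) (T : ℝ) (b : ℝ → ToyModel.Phase N),
          0 ≤ T ∧ ToyModel.IsSolution b ∧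
          b 0 = (x : ToyModel.Phase N) ∧ b T = (y : ToyModel.Phase N) ∧
          (∃ p ∈ ToyModel.circle N 3, dist x p < ε) ∧
          (∃ q ∈ ToyModel.circle N (N - 2), dist y q < ε) ∧
          (1 - ε ≤ ‖ToyModel.mode (b 0) 3‖ ∧
            ∀ j : ℕ, j ≠ 3 → ‖ToyModel.mode (b 0) j‖ ≤ ε) ∧
          (1 - ε ≤ ‖ToyModel.mode (b T) (N - 2)‖ ∧
            ∀ j : ℕ, j ≠ N - 2 → ‖ToyModel.mode (b T) j‖ ≤ ε) ∧
          (∀ t : ℝ, 0 ≤ t → t ≤ T →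
            c ≤ ToyModel.supNorm (b t) ∧ ToyModel.supNorm (b t) ≤ C) := by
  refine ⟨1 / 2, 1, by norm_num, one_pos, fun N hN ε hε => ?_⟩
  obtain ⟨K, Φ, hK, hΦ⟩ := ToyModel.exists_sphereFlow N
  obtain ⟨e, he, he1, heε, he2⟩ : ∃ e : ℝ, 0 < e ∧ e ≤ 1 / 2 ∧ e ≤ ε ∧ 2 * e < ε ^ 2 := by
    refine ⟨min (1 / 2) (min ε (ε ^ 2 / 4)), by positivity, min_le_left _ _,
      (min_le_right _ _).trans (min_le_left _ _), ?_⟩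
    have : min (1 / 2) (min ε (ε ^ 2 / 4)) ≤ ε ^ 2 / 4 :=
      (min_le_right _ _).trans (min_le_right _ _)
    nlinarith [sq_pos_of_pos hε]
  -- The index `k = N - 4` belongs to the circle of the mode `k + 2 = N - 2`. Any point of the
  -- crossing would do; the source is flowed back to the third circle.
  obtain ⟨y, _, hj, -⟩ := ToyModel.crossing_all hΦ hK he (k := N - 4) (by omega) (by omega) e he
  obtain ⟨hyn, ⟨T, hT, hT3, hTs⟩, -, hye, -⟩ := hj.source_mem
  rw [show N - 4 + 2 = N - 2 by omega] at hye
  have hxn : ‖Φ (-T) y‖ = 1 := hΦ.norm _ _ hyn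
  have hbT : Φ T (Φ (-T) y) = y := by rw [hΦ.add, add_neg_cancel, hΦ.zero]
  have hx := ToyModel.near_circle (x := ⟨Φ (-T) y, by simpa using hxn⟩) (by norm_num) (by omega)
    hε he1 heε he2 hT3
  have hy := ToyModel.near_circle (x := ⟨y, by simpa using hyn⟩) (by omega) (by omega)
    hε he1 heε he2 hye
  refine ⟨⟨Φ (-T) y, by simpa using hxn⟩, ⟨y, by simpa using hyn⟩, T, fun t => Φ t (Φ (-T) y), hT,
    hΦ.hasDerivAt _ hxn, hΦ.zero _, hbT, hx.1, hy.1, ?_, ?_, fun t ht htT => ⟨?_, ?_⟩⟩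
  · simpa only [hΦ.zero] using hx.2
  · simpa only [hbT] using hy.2
  · have := hTs (T - t) ⟨by linarith, by linarith⟩
    simp only [hΦ.add]
    rw [show t + -T = -(T - t) by ring]
    exact this.le
  · exact (ToyModel.supNorm_le_norm _).trans (hΦ.norm _ _ hxn).le
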